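/- **Setting.** Let $n\ge 1$, $p\in[0,1]$, $1\le k\le n$ (real) and $q\in[0,\tfrac12]$. Consider random directed graphs $G$ on the vertex set $[n]$ with at most one directed edge between any two distinct vertices. Under the *null model* $\mathcal Q$, independently for every pair $\{i,j\}$, the edge $i\to j$ is present with probability $\tfrac12 p$, the edge $j\to i$ with probability $\tfrac12 p$, and neither with probability $1-p$. Under the *planted model* $\mathcal P$, a random set $S\subseteq[n]$ is drawn that contains each vertex independently with probability $k/n$; then a uniformly random permutation $\pi$ of $S$ is drawn; then, independently over pairs given $(S,\pi)$: for $i,j\in S$ with $\pi(i)<\pi(j)$, the edge $i\to j$ is present with probability $p(\tfrac12+q)$, the edge $j\to i$ with probability $p(\tfrac12-q)$, and neither with probability $1-p$; for a pair $\{i,j\}\not\subseteq S$, each direction is present with probability $\tfrac12p$ and neither with probability $1-p$. A *test* is a sequence $A=(A_n)$ of arbitrary functions from directed graphs on $[n]$ to $\{0,1\}$, with total error $$\mathrm{err}_n(A)=\Pr_{G\sim\mathcal Q}[A_n(G)=1]+\Pr_{G\sim\mathcal P}[A_n(G)=0].$$ It achieves *strong detection* if $\lim_{n\to\infty}\mathrm{err}_n(A)=0$,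 and *weak detection* if $\limsup_{n\to\infty}\mathrm{err}_n(A)\le 1-\delta$ for some $\delta>0$. Either notion is *statistically possible* if some test achieves it, and *statistically impossible* otherwise. **Theorem (statistical detection in the log-density setting).** Let $\alpha,\beta,\gamma\in(0,1)$ and let $q=n^{-\alpha}$, $k=n^{\beta}$, $p=n^{-\gamma}$ (admissible parameters for all sufficiently large $n$). 1. If $\beta>\min\{2\alpha+\gamma,\ \tfrac23\alpha+\tfrac13\gamma+\tfrac12\}$, then strong detection between $\mathcal P$ and $\mathcal Q$ is statistically possible. 2. If $\beta<\min\{2\alpha+\gamma,\ \tfrac23\alpha+\tfrac13\gamma+\tfrac12\}$, then weak detection (and therefore also strong detection) between $\mathcal P$ and $\mathcal Q$ is statistically impossible. -/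

import Mathlib

open Filter Topology

noncomputable section

namespace PRS

/-- A simple directed graph on `n` labelled vertices with at most one directed edge between any two
vertices, given by its skew-symmetric adjacency matrix with entries in `{-1, 0, 1}`:
`Y i j = 1` means that the edge from `i` to `j` is present, `Y i j = -1` that the edge from `j`
to `i` is present, `Y i j = 0` that there is no edge between `i` and `j`. -/
abbrev OrientedGraph (n : ℕ) : Type :=
  {Y : Matrix (Fin n) (Fin n) SignType // ∀ i j, Y j i = -Y i j}

/-- The unordered pairs of distinct vertices, each listed once as `(i, j)` with `i < j`. -/
def pairs (n : ℕ) : Finset (Fin n × Fin n) :=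
  Finset.univ.filter fun e => e.1 < e.2

/-- The law of one adjacency entry `Y i j`: there is an edge `i → j` with probability `p (1/2 + r)`,
an edge `j → i` with probability `p (1/2 - r)`, and no edge with probability `1 - p`. -/
def edgeMass (p r : ℝ) (y : SignType) : ℝ :=
  if y = 1 then p * (1 / 2 + r) else if y = -1 then p * (1 / 2 - r) else 1 - p

/-- The bias of the pair `(i, j)`, `i ≠ j`, given the ranked community `S` and the permutation `π`
of `S`: it is `q` if `i, j ∈ S` and `π i < π j`, it is `-q` if `i, j ∈ S` and `π j < π i`, and it
is `0` if at most one of `i, j` is in `S`. -/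
def bias {n : ℕ} (q : ℝ) (S : Finset (Fin n)) (π : Equiv.Perm {x : Fin n // x ∈ S})
    (i j : Fin n) : ℝ :=
  if h : i ∈ S ∧ j ∈ S then (if π ⟨i, h.1⟩ < π ⟨j, h.2⟩ then q else -q) else 0

/-- Probability mass function of the null model with edge probability `p`. -/
def nullMass (n : ℕ) (p : ℝ) (Y : OrientedGraph n) : ℝ :=
  ∏ e ∈ pairs n, edgeMass p 0 (Y.1 e.1 e.2)

/-- Conditional probability mass function of the planted model given `S` and `π`. -/
def condMass {n : ℕ} (p q : ℝ) (S : Finset (Fin n)) (π : Equiv.Perm {x : Fin n // x ∈ S})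
    (Y : OrientedGraph n) : ℝ :=
  ∏ e ∈ pairs n, edgeMass p (bias q S π e.1 e.2) (Y.1 e.1 e.2)

/-- The probability that the ranked community is `S`, when each of the `n` vertices is included
independently with probability `k / n`. -/
def communityMass (n : ℕ) (k : ℝ) (S : Finset (Fin n)) : ℝ :=
  (k / n) ^ S.card * (1 - k / n) ^ (n - S.card)

/-- Probability mass function of the planted model with parameters `p`, `k`, `q`: the community `S`
is random, the permutation `π` of `S` is uniform, and the edges are independent given `(S, π)`. -/
def plantedMass (n : ℕ) (p k q : ℝ) (Y : OrientedGraph n) : ℝ :=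
  ∑ S : Finset (Fin n), communityMass n k S *
    ∑ π : Equiv.Perm {x : Fin n // x ∈ S}, (1 / (S.card.factorial : ℝ)) * condMass p q S π Y

/-- A sequence of tests: for each `n`, a function from graphs on `n` vertices to `{0, 1}`
(`true` is `1`, that is, "planted"; `false` is `0`, that is, "null"). -/
abbrev Test : Type := (n : ℕ) → OrientedGraph n → Bool

/-- Sum of the Type I and the Type II error probabilities of the test `A` at size `n`, between
`Q` (null) and `P` (alternative), both given by their mass functions. -/
def totalError (Q P : (n : ℕ) → OrientedGraph n → ℝ) (A : Test) (n : ℕ) : ℝ :=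
  (∑ Y ∈ Finset.univ.filter (fun Y => A n Y = true), Q n Y) +
    ∑ Y ∈ Finset.univ.filter (fun Y => A n Y = false), P n Y

/-- `A` achieves strong detection between `P` and `Q`. -/
def StrongDetection (Q P : (n : ℕ) → OrientedGraph n → ℝ) (A : Test) : Prop :=
  Tendsto (totalError Q P A) atTop (𝓝 0)

/-- `A` achieves weak detection between `P` and `Q`. -/
def WeakDetection (Q P : (n : ℕ) → OrientedGraph n → ℝ) (A : Test) : Prop :=
  ∃ δ : ℝ, 0 < δ ∧ limsup (totalError Q P A) atTop ≤ 1 - δ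

/-- The null model in the log-density setting: `p = n ^ (-γ)`. -/
def logNull (γ : ℝ) (n : ℕ) : OrientedGraph n → ℝ :=
  nullMass n ((n : ℝ) ^ (-γ))

/-- The planted model in the log-density setting: `p = n ^ (-γ)`, `k = n ^ β`, `q = n ^ (-α)`.
For `α, β, γ ∈ (0, 1)` these are admissible parameters (`0 ≤ p ≤ 1`, `1 ≤ k ≤ n`, `0 ≤ q ≤ 1/2`)
for all sufficiently large `n`; the finitely many other `n` play no role in the limit. -/
def logPlanted (α β γ : ℝ) (n : ℕ) : OrientedGraph n → ℝ :=
  plantedMass n ((n : ℝ) ^ (-γ)) ((n : ℝ) ^ β) ((n : ℝ) ^ (-α))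

end PRS

end

/-!
For the **upper bound** there are two tests, one for each term of the minimum; each is analysed
conditionally on the ranked community, which has at least `k / 2` members with high probability.

* If `p q² k` grows polynomially, scan over all ranked sets and count the edges that agree with the
  ranking minus those that disagree. For a planted community of size `m` this agreement is about
  `p q m²` with variance at most `p m²` (`scan_planted_le`), while Chernoff's bound and the union
  bound over the at most `n ^ m` ranked sets of size `m` exclude such an agreement in the null model
  (`scan_null_le`).
* If `p q² k³` is polynomially larger than `n ^ (3 / 2)`, use the sum over all vertices of
  `(out-degree - in-degree)²`. A community of size `m` raises its mean by about
  `(4 / 3) p² q² m³`, whatever the ranking (`degreeStat_planted_mean`), and the variance is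
  controlled by the Efron–Stein inequality (`efronStein`, `edgeExp_quadForm_sub_sq_le`).

For the **lower bound**, consider the likelihood ratio of the planted and the null model, restricted
to communities with at most `2 k` members. Its second moment is an average, over two independent
ranked communities, of a product over the pairs inside the intersection of the two, and this product
is at most the exponential of `4 p q²` times Kendall's statistic of the two induced rankings
(`permAvg_permAvg_prod_le`). The ranking that a uniform ranking induces on a subset is again uniform
(`permAvg_transfer`), and Kendall's statistic of a uniform permutation of `m` points is a sum of
independent symmetric variables bounded by `0, …, m - 1`; so the average over rankings is at most
`exp (8 (p q²)² m³)`, where `m` is the size of the intersection (`permAvg_exp_kendall_le`). As `m`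
has mean `k² / n` and `m ≤ 2 k`, the second moment tends to `1` when `p q² k` and
`(p q²)² (k² / n)³` vanish polynomially fast (`edgeExp_truncRatio_sq_le`). Then every test has
total error `1 - o(1)` (`one_sub_sqrt_le_error`).
-/

namespace PRS

/-! ### Expectations over finite product spaces -/

section ProductExpectation

variable {ι Ω : Type*} [Fintype ι] [DecidableEq ι] [Fintype Ω]

/-- The expectation of `f ω` when the coordinates `ω e` are independent and `ω e` has mass
function `w e`. -/
def prodExp (w : ι → Ω → ℝ) (f : (ι → Ω) → ℝ) : ℝ :=
  ∑ ω, (∏ e, w e (ω e)) * f ω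

/-- The conditional expectation of `f` given all coordinates but `a`, as a function of `ω`. -/
def avgCoord (w : ι → Ω → ℝ) (a : ι) (f : (ι → Ω) → ℝ) (ω : ι → Ω) : ℝ :=
  ∑ y, w a y * f (Function.update ω a y)

variable {w : ι → Ω → ℝ}

lemma prodExp_prod (g : ι → Ω → ℝ) :
    prodExp w (fun ω => ∏ e, g e (ω e)) = ∏ e, ∑ y, w e y * g e y := by
  unfold prodExp
  simp_rw [← Finset.prod_mul_distrib]
  rw [Finset.prod_univ_sum, Fintype.piFinset_univ]

lemma prodExp_add (f g : (ι → Ω) → ℝ) :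
    prodExp w (fun ω => f ω + g ω) = prodExp w f + prodExp w g := by
  simp only [prodExp, mul_add, Finset.sum_add_distrib]

lemma prodExp_sub (f g : (ι → Ω) → ℝ) :
    prodExp w (fun ω => f ω - g ω) = prodExp w f - prodExp w g := by
  simp only [prodExp, mul_sub, Finset.sum_sub_distrib]

lemma prodExp_const_mul (c : ℝ) (f : (ι → Ω) → ℝ) :
    prodExp w (fun ω => c * f ω) = c * prodExp w f := by
  simp only [prodExp, Finset.mul_sum]
  exact Finset.sum_congr rfl fun _ _ => by ring

lemma prodExp_sum {κ : Type*} (s : Finset κ) (f : κ → (ι → Ω) → ℝ) :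
    prodExp w (fun ω => ∑ a ∈ s, f a ω) = ∑ a ∈ s, prodExp w (f a) := by
  simp only [prodExp, Finset.mul_sum]
  exact Finset.sum_comm

lemma prodExp_const (hw1 : ∀ e, ∑ y, w e y = 1) (c : ℝ) : prodExp w (fun _ => c) = c := by
  have h := prodExp_prod (w := w) (fun _ _ => 1)
  simp only [Finset.prod_const_one, mul_one, hw1] at h
  have h2 := prodExp_const_mul (w := w) c (fun _ => 1)
  simpa [h] using h2

lemma prodExp_mono (hw0 : ∀ e y, 0 ≤ w e y) {f g : (ι → Ω) → ℝ} (h : ∀ ω, f ω ≤ g ω) :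
    prodExp w f ≤ prodExp w g :=
  Finset.sum_le_sum fun ω _ =>
    mul_le_mul_of_nonneg_left (h ω) (Finset.prod_nonneg fun e _ => hw0 e _)

lemma prodExp_nonneg (hw0 : ∀ e y, 0 ≤ w e y) {f : (ι → Ω) → ℝ} (h : ∀ ω, 0 ≤ f ω) :
    0 ≤ prodExp w f :=
  Finset.sum_nonneg fun ω _ => mul_nonneg (Finset.prod_nonneg fun e _ => hw0 e _) (h ω)

omit [Fintype Ω] in
lemma prod_update_mul (ω : ι → Ω) (a : ι) (y : Ω) :
    (∏ e, w e (Function.update ω a y e)) * w a (ω a) = (∏ e, w e (ω e)) * w a y := by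
  rw [← Finset.mul_prod_erase _ (fun e => w e (Function.update ω a y e)) (Finset.mem_univ a),
    ← Finset.mul_prod_erase _ (fun e => w e (ω e)) (Finset.mem_univ a)]
  have : ∏ e ∈ Finset.univ.erase a, w e (Function.update ω a y e)
      = ∏ e ∈ Finset.univ.erase a, w e (ω e) :=
    Finset.prod_congr rfl fun e he => by
      rw [Function.update_of_ne (Finset.ne_of_mem_erase he)]
  rw [this, Function.update_self]
  ring

/-- Resampling a coordinate does not change the expectation (tower property). -/
lemma prodExp_avgCoord (hw1 : ∀ e, ∑ y, w e y = 1) (a : ι) (f : (ι → Ω) → ℝ) :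
    prodExp w (avgCoord w a f) = prodExp w f := by
  -- exchanging the old and the fresh value of the coordinate is a weight-preserving involution
  let φ : (ι → Ω) × Ω ≃ (ι → Ω) × Ω :=
    { toFun := fun z => (Function.update z.1 a z.2, z.1 a)
      invFun := fun z => (Function.update z.1 a z.2, z.1 a)
      left_inv := fun z => by simp
      right_inv := fun z => by simp }
  have h1 : prodExp w (avgCoord w a f)
      = ∑ z : (ι → Ω) × Ω, (∏ e, w e ((φ z).1 e)) * w a (φ z).2 * f (φ z).1 := by
    rw [Fintype.sum_prod_type]
    unfold prodExp avgCoord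
    refine Finset.sum_congr rfl fun ω _ => ?_
    rw [Finset.mul_sum]
    refine Finset.sum_congr rfl fun y _ => ?_
    simp only [φ, Equiv.coe_fn_mk]
    rw [prod_update_mul, mul_assoc]
  rw [h1, Equiv.sum_comp φ (fun z => (∏ e, w e (z.1 e)) * w a z.2 * f z.1),
    Fintype.sum_prod_type]
  unfold prodExp
  refine Finset.sum_congr rfl fun ω _ => ?_
  simp only []
  rw [← Finset.sum_mul, ← Finset.mul_sum, hw1, mul_one]

/-- A function of the coordinate `a` and a function of the other coordinates are independent. -/
lemma prodExp_mul_of_update (hw1 : ∀ e, ∑ y, w e y = 1) (a : ι) (u : Ω → ℝ)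
    (v : (ι → Ω) → ℝ) (hv : ∀ ω y, v (Function.update ω a y) = v ω) :
    prodExp w (fun ω => u (ω a) * v ω) = (∑ y, w a y * u y) * prodExp w v := by
  rw [← prodExp_avgCoord hw1 a, ← prodExp_const_mul]
  congr 1
  funext ω
  simp only [avgCoord, hv, Function.update_self, Finset.sum_mul, mul_assoc]

lemma prodExp_coord (hw1 : ∀ e, ∑ y, w e y = 1) (a : ι) (u : Ω → ℝ) :
    prodExp w (fun ω => u (ω a)) = ∑ y, w a y * u y := by
  have := prodExp_mul_of_update hw1 a u (fun _ => 1) (fun _ _ => rfl)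
  simpa [prodExp_const hw1] using this

omit [Fintype ι] in
lemma avgCoord_update (a : ι) (f : (ι → Ω) → ℝ) (ω : ι → Ω) (y : Ω) :
    avgCoord w a f (Function.update ω a y) = avgCoord w a f ω := by
  simp [avgCoord]

omit [Fintype ι] in
lemma avgCoord_update_of_ne {a e : ι} (h : e ≠ a) {f : (ι → Ω) → ℝ}
    (hf : ∀ ω y, f (Function.update ω e y) = f ω) (ω : ι → Ω) (y : Ω) :
    avgCoord w a f (Function.update ω e y) = avgCoord w a f ω := by
  unfold avgCoord
  refine Finset.sum_congr rfl fun z _ => ?_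
  rw [Function.update_comm h, hf]

omit [Fintype ι] in
lemma sq_avgCoord_le (hw0 : ∀ e y, 0 ≤ w e y) (hw1 : ∀ e, ∑ y, w e y = 1) (a : ι)
    (f : (ι → Ω) → ℝ) (ω : ι → Ω) :
    avgCoord w a f ω ^ 2 ≤ avgCoord w a (fun ω => f ω ^ 2) ω :=
  Real.pow_arith_mean_le_arith_mean_pow_of_even _ _ _ (fun y _ => hw0 a y) (hw1 a) even_two

lemma prodExp_mul_avgCoord (hw1 : ∀ e, ∑ y, w e y = 1) (a : ι) (f h : (ι → Ω) → ℝ)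
    (hh : ∀ ω y, h (Function.update ω a y) = h ω) :
    prodExp w (fun ω => f ω * h ω) = prodExp w (fun ω => avgCoord w a f ω * h ω) := by
  rw [← prodExp_avgCoord hw1 a]
  congr 1
  funext ω
  simp only [avgCoord, hh, Finset.sum_mul, mul_assoc]

/-- Averaging over the coordinate `a` is the orthogonal projection onto the functions that do not
depend on `a`: this is Pythagoras for such a function `h`. -/
lemma prodExp_sq_sub (hw1 : ∀ e, ∑ y, w e y = 1) (a : ι) (f h : (ι → Ω) → ℝ)
    (hh : ∀ ω y, h (Function.update ω a y) = h ω) :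
    prodExp w (fun ω => (f ω - h ω) ^ 2) = prodExp w (fun ω => (f ω - avgCoord w a f ω) ^ 2)
      + prodExp w (fun ω => (avgCoord w a f ω - h ω) ^ 2) := by
  have h1 := prodExp_mul_avgCoord hw1 a f (fun ω => avgCoord w a f ω - h ω)
    (fun ω y => by rw [avgCoord_update, hh])
  have h2 : prodExp w (fun ω => (f ω - h ω) ^ 2)
      = prodExp w (fun ω => (f ω - avgCoord w a f ω) ^ 2)
      + prodExp w (fun ω => (avgCoord w a f ω - h ω) ^ 2)
      + 2 * (prodExp w (fun ω => f ω * (avgCoord w a f ω - h ω))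
        - prodExp w (fun ω => avgCoord w a f ω * (avgCoord w a f ω - h ω))) := by
    rw [← prodExp_sub, ← prodExp_const_mul, ← prodExp_add, ← prodExp_add]
    congr 1
    funext ω
    ring
  rw [h2, h1]
  ring

lemma prodExp_sq_sub_avgCoord_le (hw0 : ∀ e y, 0 ≤ w e y) (hw1 : ∀ e, ∑ y, w e y = 1) (a : ι)
    (f h : (ι → Ω) → ℝ) (hh : ∀ ω y, h (Function.update ω a y) = h ω) :
    prodExp w (fun ω => (f ω - avgCoord w a f ω) ^ 2) ≤ prodExp w (fun ω => (f ω - h ω) ^ 2) := by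
  rw [prodExp_sq_sub hw1 a f h hh]
  have := prodExp_nonneg hw0 (f := fun ω => (avgCoord w a f ω - h ω) ^ 2) (fun ω => sq_nonneg _)
  linarith

/-- The Efron–Stein inequality for functions of the coordinates in `s`: the coordinates are
averaged out one at a time, and each step loses at most the corresponding summand. -/
lemma variance_le_of_dependsOn (hw0 : ∀ e y, 0 ≤ w e y) (hw1 : ∀ e, ∑ y, w e y = 1)
    (s : Finset ι) : ∀ (f : (ι → Ω) → ℝ) (f' : ι → (ι → Ω) → ℝ),
    (∀ e ∉ s, ∀ ω y, f (Function.update ω e y) = f ω) →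
    (∀ e ω y, f' e (Function.update ω e y) = f' e ω) →
    prodExp w (fun ω => f ω ^ 2) - prodExp w f ^ 2
      ≤ ∑ e ∈ s, prodExp w (fun ω => (f ω - f' e ω) ^ 2) := by
  induction s using Finset.induction_on with
  | empty =>
    intro f f' hf hf'
    have hconst : ∀ ω ω', f ω = f ω' := by
      intro ω ω'
      have : ∀ t : Finset ι, f (fun e => if e ∈ t then ω' e else ω e) = f ω := by
        intro t
        induction t using Finset.induction_on with
        | empty => simp
        | insert a t ha ih =>
          rw [← ih, ← hf a (by simp) (fun e => if e ∈ t then ω' e else ω e) (ω' a)]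
          congr 1
          funext e
          by_cases hea : e = a
          · subst hea; simp
          · simp [hea]
      have h := this Finset.univ
      simpa using h.symm
    rcases isEmpty_or_nonempty (ι → Ω) with h | ⟨⟨ω0⟩⟩
    · simp [prodExp]
    · have hf0 : f = fun _ => f ω0 := funext fun ω => hconst ω ω0
      rw [hf0]
      simp [prodExp_const hw1]
  | insert a s ha ih =>
    intro f f' hf hf'
    have hg := ih (avgCoord w a f) (fun e => avgCoord w a (f' e))
      (fun e he ω y => by
        by_cases hea : e = a
        · subst hea; exact avgCoord_update _ _ _ _
        · exact avgCoord_update_of_ne hea (hf e (by simp [hea, he])) ω y)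
      (fun e ω y => by
        by_cases hea : e = a
        · subst hea; exact avgCoord_update _ _ _ _
        · exact avgCoord_update_of_ne hea (hf' e) ω y)
    rw [prodExp_avgCoord hw1] at hg
    have h1 := prodExp_sq_sub hw1 a f (fun _ => 0) (fun _ _ => rfl)
    simp only [sub_zero] at h1
    have h2 := prodExp_sq_sub_avgCoord_le hw0 hw1 a f (f' a) (hf' a)
    have h3 : ∑ e ∈ s, prodExp w (fun ω => (avgCoord w a f ω - avgCoord w a (f' e) ω) ^ 2)
        ≤ ∑ e ∈ s, prodExp w (fun ω => (f ω - f' e ω) ^ 2) := by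
      refine Finset.sum_le_sum fun e _ => ?_
      rw [← prodExp_avgCoord hw1 a (fun ω => (f ω - f' e ω) ^ 2)]
      refine prodExp_mono hw0 fun ω => ?_
      have : avgCoord w a f ω - avgCoord w a (f' e) ω
          = avgCoord w a (fun ω => f ω - f' e ω) ω := by
        simp only [avgCoord, mul_sub, Finset.sum_sub_distrib]
      rw [this]
      exact sq_avgCoord_le hw0 hw1 a _ ω
    rw [Finset.sum_insert ha]
    linarith

/-- The **Efron–Stein inequality**; each `f' e` may be any function that does not depend on the
coordinate `e`. -/
lemma efronStein (hw0 : ∀ e y, 0 ≤ w e y) (hw1 : ∀ e, ∑ y, w e y = 1)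
    (f : (ι → Ω) → ℝ) (f' : ι → (ι → Ω) → ℝ)
    (hf' : ∀ e ω y, f' e (Function.update ω e y) = f' e ω) :
    prodExp w (fun ω => (f ω - prodExp w f) ^ 2)
      ≤ ∑ e, prodExp w (fun ω => (f ω - f' e ω) ^ 2) := by
  have h := variance_le_of_dependsOn hw0 hw1 Finset.univ f f' (fun e he => by simp at he) hf'
  have h2 : prodExp w (fun ω => (f ω - prodExp w f) ^ 2)
      = prodExp w (fun ω => f ω ^ 2) - prodExp w f ^ 2 := by
    have : ∀ ω, (f ω - prodExp w f) ^ 2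
        = f ω ^ 2 - (2 * prodExp w f) * f ω + prodExp w f ^ 2 := fun ω => by ring
    simp only [this]
    rw [prodExp_add, prodExp_sub, prodExp_const_mul, prodExp_const hw1]
    ring
  rw [h2]
  exact h

/-- Chebyshev's inequality, for an event on which `f` is at distance at least `t` from `m`. -/
lemma prodExp_indicator_le (hw0 : ∀ e y, 0 ≤ w e y) (f : (ι → Ω) → ℝ) (m : ℝ) {t : ℝ}
    (ht : 0 < t) (P : (ι → Ω) → Prop) [DecidablePred P] (hP : ∀ ω, P ω → t ≤ |f ω - m|) :
    prodExp w (fun ω => if P ω then 1 else 0)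
      ≤ prodExp w (fun ω => (f ω - m) ^ 2) / t ^ 2 := by
  rw [div_eq_inv_mul, ← prodExp_const_mul]
  refine prodExp_mono hw0 fun ω => ?_
  split_ifs with h
  · have h1 : t ^ 2 ≤ (f ω - m) ^ 2 := by
      rw [← sq_abs (f ω - m)]
      exact pow_le_pow_left₀ ht.le (hP ω h) 2
    rw [← div_eq_inv_mul, le_div_iff₀ (by positivity)]
    linarith
  · positivity

end ProductExpectation

/-! ### Linear and quadratic statistics of independent edges -/

lemma sum_signType (f : SignType → ℝ) : ∑ y, f y = f 0 + f (-1) + f 1 := by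
  have : (Finset.univ : Finset SignType) = {0, -1, 1} := by decide
  rw [this, Finset.sum_insert (by decide), Finset.sum_insert (by decide), Finset.sum_singleton]
  ring

lemma edgeMass_zero (p r : ℝ) : edgeMass p r 0 = 1 - p := by
  simp [edgeMass]

lemma edgeMass_one (p r : ℝ) : edgeMass p r 1 = p * (1 / 2 + r) := by
  simp [edgeMass]

lemma edgeMass_neg_one (p r : ℝ) : edgeMass p r (-1) = p * (1 / 2 - r) := by
  simp [edgeMass]

lemma edgeMass_nonneg {p r : ℝ} (hp0 : 0 ≤ p) (hp1 : p ≤ 1) (hr : |r| ≤ 1 / 2) (y : SignType) :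
    0 ≤ edgeMass p r y := by
  obtain ⟨h1, h2⟩ := abs_le.1 hr
  rcases y with _ | _ | _
  · change 0 ≤ edgeMass p r 0
    rw [edgeMass_zero]; linarith
  · change 0 ≤ edgeMass p r (-1)
    rw [edgeMass_neg_one]; exact mul_nonneg hp0 (by linarith)
  · change 0 ≤ edgeMass p r 1
    rw [edgeMass_one]; exact mul_nonneg hp0 (by linarith)

lemma sum_edgeMass (p r : ℝ) : ∑ y, edgeMass p r y = 1 := by
  rw [sum_signType, edgeMass_zero, edgeMass_one, edgeMass_neg_one]; ring

lemma sum_edgeMass_mul (p r : ℝ) : ∑ y : SignType, edgeMass p r y * (y : ℝ) = 2 * p * r := by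
  rw [sum_signType, edgeMass_zero, edgeMass_one, edgeMass_neg_one]; simp; ring

lemma sum_edgeMass_mul_sq (p r : ℝ) : ∑ y : SignType, edgeMass p r y * (y : ℝ) ^ 2 = p := by
  rw [sum_signType, edgeMass_zero, edgeMass_one, edgeMass_neg_one]; simp; ring

lemma signType_pow_four (y : SignType) : (y : ℝ) ^ 4 = (y : ℝ) ^ 2 := by
  rcases y with _ | _ | _ <;> norm_num

section Forms

variable {ι : Type*} [Fintype ι] [DecidableEq ι]

/-- The expectation of a function of independent edge variables, where the edge variable `e` is
present with probability `p` and has bias `r e`. -/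
noncomputable def edgeExp (p : ℝ) (r : ι → ℝ) (f : (ι → SignType) → ℝ) : ℝ :=
  prodExp (fun e => edgeMass p (r e)) f

/-- The linear statistic with coefficients `c`. -/
def linForm (c : ι → ℝ) (ω : ι → SignType) : ℝ :=
  ∑ e, c e * (ω e : ℝ)

variable {p : ℝ} {r : ι → ℝ}

lemma edgeExp_coord_mul_coord (e f : ι) :
    edgeExp p r (fun ω => (ω e : ℝ) * (ω f : ℝ))
      = (2 * p * r e) * (2 * p * r f) + if e = f then p - (2 * p * r e) ^ 2 else 0 := by
  have hw1 : ∀ e, ∑ y, edgeMass p (r e) y = 1 := fun e => sum_edgeMass p (r e)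
  unfold edgeExp
  split_ifs with h
  · subst h
    have := prodExp_coord hw1 e (fun y => (y : ℝ) ^ 2)
    rw [sum_edgeMass_mul_sq] at this
    simp only [sq] at this
    rw [this]
    ring
  · rw [prodExp_mul_of_update hw1 e (fun y => (y : ℝ)) (fun ω => (ω f : ℝ))
      (fun ω y => by rw [Function.update_of_ne (Ne.symm h)]),
      prodExp_coord hw1 f (fun y => (y : ℝ)), sum_edgeMass_mul, sum_edgeMass_mul, add_zero]

lemma edgeExp_linForm (c : ι → ℝ) :
    edgeExp p r (linForm c) = ∑ e, c e * (2 * p * r e) := by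
  have hw1 : ∀ e, ∑ y, edgeMass p (r e) y = 1 := fun e => sum_edgeMass p (r e)
  unfold edgeExp linForm
  rw [prodExp_sum]
  refine Finset.sum_congr rfl fun e _ => ?_
  rw [prodExp_const_mul, prodExp_coord hw1 e (fun y => (y : ℝ)), sum_edgeMass_mul]

lemma edgeExp_linForm_sq (c : ι → ℝ) :
    edgeExp p r (fun ω => linForm c ω ^ 2)
      = (∑ e, c e * (2 * p * r e)) ^ 2 + ∑ e, c e ^ 2 * (p - (2 * p * r e) ^ 2) := by
  have h1 : ∀ ω : ι → SignType, linForm c ω ^ 2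
      = ∑ e, ∑ f, (c e * c f) * ((ω e : ℝ) * (ω f : ℝ)) := by
    intro ω
    rw [sq, linForm, Finset.sum_mul_sum]
    exact Finset.sum_congr rfl fun e _ => Finset.sum_congr rfl fun f _ => by ring
  simp only [h1]
  unfold edgeExp
  rw [prodExp_sum]
  simp only [prodExp_sum, prodExp_const_mul]
  have h2 := fun e f => edgeExp_coord_mul_coord (p := p) (r := r) e f
  unfold edgeExp at h2
  simp only [h2, mul_add, Finset.sum_add_distrib, mul_ite, mul_zero, Finset.sum_ite_eq,
    Finset.mem_univ, if_true]
  congr 1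
  · rw [sq, Finset.sum_mul_sum]
    exact Finset.sum_congr rfl fun e _ => Finset.sum_congr rfl fun f _ => by ring
  · exact Finset.sum_congr rfl fun e _ => by ring

lemma edgeExp_linForm_sub_sq (c : ι → ℝ) :
    edgeExp p r (fun ω => (linForm c ω - edgeExp p r (linForm c)) ^ 2)
      = ∑ e, c e ^ 2 * (p - (2 * p * r e) ^ 2) := by
  have hw1 : ∀ e, ∑ y, edgeMass p (r e) y = 1 := fun e => sum_edgeMass p (r e)
  set m := edgeExp p r (linForm c) with hm
  have : ∀ ω, (linForm c ω - m) ^ 2 = linForm c ω ^ 2 - (2 * m) * linForm c ω + m ^ 2 :=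
    fun ω => by ring
  simp only [this]
  have h2 := edgeExp_linForm_sq (p := p) (r := r) c
  have h3 := edgeExp_linForm (p := p) (r := r) c
  rw [← hm] at h3
  unfold edgeExp at *
  rw [prodExp_add, prodExp_sub, prodExp_const_mul, prodExp_const hw1, ← hm, h2, ← h3]
  ring

lemma linForm_eq_add (c : ι → ℝ) (e : ι) (ω : ι → SignType) :
    linForm c ω = c e * (ω e : ℝ) + linForm (Function.update c e 0) ω := by
  unfold linForm
  rw [← Finset.add_sum_erase _ (fun f => c f * (ω f : ℝ)) (Finset.mem_univ e),
    ← Finset.add_sum_erase _ (fun f => Function.update c e 0 f * (ω f : ℝ)) (Finset.mem_univ e)]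
  simp only [Function.update_self, zero_mul, zero_add]
  congr 1
  refine Finset.sum_congr rfl fun f hf => ?_
  rw [Function.update_of_ne (Finset.ne_of_mem_erase hf)]

lemma linForm_update_update (c : ι → ℝ) (e : ι) (ω : ι → SignType) (y : SignType) :
    linForm (Function.update c e 0) (Function.update ω e y)
      = linForm (Function.update c e 0) ω := by
  unfold linForm
  refine Finset.sum_congr rfl fun f _ => ?_
  by_cases h : f = e
  · subst h; simp
  · rw [Function.update_of_ne h, Function.update_of_ne h]

lemma sq_mean_le (hp0 : 0 ≤ p) (hp1 : p ≤ 1) {x : ℝ} (hx : |x| ≤ 1 / 2) :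
    (2 * p * x) ^ 2 ≤ p := by
  have h1 : x ^ 2 ≤ (1 / 2) ^ 2 := by
    rw [← sq_abs]; exact pow_le_pow_left₀ (abs_nonneg _) hx 2
  nlinarith [sq_nonneg x, mul_nonneg hp0 hp0, mul_le_mul_of_nonneg_left h1 (mul_nonneg hp0 hp0)]

lemma edgeExp_linForm_update_sq_le (hp0 : 0 ≤ p) (hp1 : p ≤ 1) (hr : ∀ e, |r e| ≤ 1 / 2)
    (c : ι → ℝ) (e : ι) (hce : c e ^ 2 ≤ 1) {N : ℝ} (hN : ∑ f, c f ^ 2 ≤ N) :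
    edgeExp p r (fun ω => linForm (Function.update c e 0) ω ^ 2)
      ≤ 2 * (∑ f, c f * (2 * p * r f)) ^ 2 + (N + 2) * p := by
  rw [edgeExp_linForm_sq]
  have hμ : ∀ f, (2 * p * r f) ^ 2 ≤ p := fun f => sq_mean_le hp0 hp1 (hr f)
  have h1 : ∑ f, Function.update c e 0 f ^ 2 * (p - (2 * p * r f) ^ 2) ≤ N * p := by
    calc ∑ f, Function.update c e 0 f ^ 2 * (p - (2 * p * r f) ^ 2)
        ≤ ∑ f, c f ^ 2 * p := by
          refine Finset.sum_le_sum fun f _ => ?_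
          have hb : p - (2 * p * r f) ^ 2 ≤ p := by linarith [sq_nonneg (2 * p * r f)]
          by_cases h : f = e
          · subst h; simp; positivity
          · rw [Function.update_of_ne h]
            exact mul_le_mul_of_nonneg_left hb (sq_nonneg _)
      _ = (∑ f, c f ^ 2) * p := by rw [Finset.sum_mul]
      _ ≤ N * p := mul_le_mul_of_nonneg_right hN hp0
  have h2 : ∑ f, Function.update c e 0 f * (2 * p * r f)
      = (∑ f, c f * (2 * p * r f)) - c e * (2 * p * r e) := by
    rw [eq_sub_iff_add_eq,
      ← Finset.add_sum_erase _ (fun f => c f * (2 * p * r f)) (Finset.mem_univ e),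
      ← Finset.add_sum_erase _ (fun f => Function.update c e 0 f * (2 * p * r f))
        (Finset.mem_univ e)]
    simp only [Function.update_self, zero_mul, zero_add]
    rw [add_comm]
    congr 1
    refine Finset.sum_congr rfl fun f hf => ?_
    rw [Function.update_of_ne (Finset.ne_of_mem_erase hf)]
  rw [h2]
  set M := ∑ f, c f * (2 * p * r f)
  have h3 : (c e * (2 * p * r e)) ^ 2 ≤ p := by
    rw [mul_pow]
    calc c e ^ 2 * (2 * p * r e) ^ 2 ≤ 1 * (2 * p * r e) ^ 2 :=
          mul_le_mul_of_nonneg_right hce (sq_nonneg _)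
      _ ≤ p := by rw [one_mul]; exact hμ e
  nlinarith [sq_nonneg (M + c e * (2 * p * r e))]

variable {κ : Type*} [Fintype κ]

/-- The quadratic statistic `∑ a, (linForm (C a))²`. -/
noncomputable def quadForm (C : κ → ι → ℝ) (ω : ι → SignType) : ℝ :=
  ∑ a, linForm (C a) ω ^ 2

lemma edgeExp_quadForm (C : κ → ι → ℝ) :
    edgeExp p r (quadForm C) = ∑ a, ((∑ e, C a e * (2 * p * r e)) ^ 2
      + ∑ e, C a e ^ 2 * (p - (2 * p * r e) ^ 2)) := by
  unfold quadForm
  have h := fun a => edgeExp_linForm_sq (p := p) (r := r) (C a)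
  unfold edgeExp at *
  rw [prodExp_sum]
  exact Finset.sum_congr rfl fun a _ => h a

/-- A variance bound for the quadratic statistic, from the Efron–Stein inequality: zeroing the
edge `e` changes the statistic by `2 y (∑ a, C a e * L a) + 2 y²`, where `y` is the edge variable
and `L a` is the `a`-th linear statistic without the edge `e`, which is independent of `y`. -/
lemma edgeExp_quadForm_sub_sq_le (hp0 : 0 ≤ p) (hp1 : p ≤ 1) (hr : ∀ e, |r e| ≤ 1 / 2)
    (C : κ → ι → ℝ) (hC3 : ∀ a e, C a e ^ 3 = C a e) (hC2 : ∀ e, ∑ a, C a e ^ 2 = 2)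
    {N : ℝ} (hN : ∀ a, ∑ e, C a e ^ 2 ≤ N) :
    edgeExp p r (fun ω => (quadForm C ω - edgeExp p r (quadForm C)) ^ 2)
      ≤ 16 * p * N * ∑ a, (2 * (∑ e, C a e * (2 * p * r e)) ^ 2 + (N + 2) * p)
        + 8 * p * Fintype.card ι := by
  have hw1 : ∀ e, ∑ y, edgeMass p (r e) y = 1 := fun e => sum_edgeMass p (r e)
  have hw0 : ∀ e y, 0 ≤ edgeMass p (r e) y := fun e y => edgeMass_nonneg hp0 hp1 (hr e) y
  have hC1 : ∀ a e, C a e ^ 2 ≤ 1 := by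
    intro a e
    have h : C a e ^ 2 * C a e ^ 2 = C a e ^ 2 := by
      calc C a e ^ 2 * C a e ^ 2 = C a e ^ 3 * C a e := by ring
        _ = C a e ^ 2 := by rw [hC3]; ring
    nlinarith [sq_nonneg (C a e), sq_nonneg (C a e ^ 2 - 1)]
  have hC4 : ∀ a e, C a e ^ 4 = C a e ^ 2 := fun a e => by
    calc C a e ^ 4 = C a e ^ 3 * C a e := by ring
      _ = C a e ^ 2 := by rw [hC3]; ring
  let L : κ → ι → (ι → SignType) → ℝ := fun a e ω => linForm (Function.update (C a) e 0) ω
  have hL : ∀ a e ω y, L a e (Function.update ω e y) = L a e ω := fun a e ω y =>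
    linForm_update_update _ _ _ _
  have hES := efronStein hw0 hw1 (quadForm C) (fun e ω => ∑ a, L a e ω ^ 2)
    (fun e ω y => by simp only [hL])
  refine hES.trans ?_
  have hstep : ∀ e, prodExp (fun e => edgeMass p (r e))
      (fun ω => (quadForm C ω - ∑ a, L a e ω ^ 2) ^ 2)
      ≤ 16 * p * (∑ a, C a e ^ 2 * (2 * (∑ f, C a f * (2 * p * r f)) ^ 2 + (N + 2) * p))
        + 8 * p := by
    intro e
    have hdiff : ∀ ω, (quadForm C ω - ∑ a, L a e ω ^ 2) ^ 2
        ≤ 16 * ((ω e : ℝ) ^ 2 * ∑ a, C a e ^ 2 * L a e ω ^ 2) + 8 * (ω e : ℝ) ^ 2 := by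
      intro ω
      have h1 : quadForm C ω - ∑ a, L a e ω ^ 2
          = 2 * (ω e : ℝ) * (∑ a, C a e * L a e ω) + 2 * (ω e : ℝ) ^ 2 := by
        have h : quadForm C ω - ∑ a, L a e ω ^ 2
            = ∑ a, (2 * (ω e : ℝ) * (C a e * L a e ω) + C a e ^ 2 * (ω e : ℝ) ^ 2) := by
          rw [quadForm, ← Finset.sum_sub_distrib]
          refine Finset.sum_congr rfl fun a _ => ?_
          rw [linForm_eq_add (C a) e ω]
          simp only [L]
          ring
        rw [h, Finset.sum_add_distrib, ← Finset.mul_sum, ← Finset.sum_mul, hC2]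
      have h2 : (∑ a, C a e * L a e ω) ^ 2 ≤ 2 * ∑ a, C a e ^ 2 * L a e ω ^ 2 := by
        have h := Finset.sum_mul_sq_le_sq_mul_sq Finset.univ (fun a => C a e)
          (fun a => C a e ^ 2 * L a e ω)
        rw [hC2] at h
        have e1 : ∀ a, C a e * (C a e ^ 2 * L a e ω) = C a e * L a e ω := fun a => by
          calc C a e * (C a e ^ 2 * L a e ω) = C a e ^ 3 * L a e ω := by ring
            _ = _ := by rw [hC3]
        have e2 : ∀ a, (C a e ^ 2 * L a e ω) ^ 2 = C a e ^ 2 * L a e ω ^ 2 := fun a => by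
          calc (C a e ^ 2 * L a e ω) ^ 2 = C a e ^ 4 * L a e ω ^ 2 := by ring
            _ = _ := by rw [hC4]
        simpa only [e1, e2] using h
      rw [h1]
      set X := ∑ a, C a e * L a e ω
      have h4 := signType_pow_four (ω e)
      have h5 : (ω e : ℝ) ^ 2 * X ^ 2
          ≤ (ω e : ℝ) ^ 2 * (2 * ∑ a, C a e ^ 2 * L a e ω ^ 2) :=
        mul_le_mul_of_nonneg_left h2 (sq_nonneg _)
      nlinarith [sq_nonneg (2 * (ω e : ℝ) * X - 2 * (ω e : ℝ) ^ 2)]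
    refine (prodExp_mono hw0 hdiff).trans ?_
    rw [prodExp_add, prodExp_const_mul, prodExp_const_mul,
      prodExp_mul_of_update hw1 e (fun y => (y : ℝ) ^ 2)
        (fun ω => ∑ a, C a e ^ 2 * L a e ω ^ 2) (fun ω y => by simp only [hL]),
      prodExp_coord hw1 e (fun y => (y : ℝ) ^ 2), sum_edgeMass_mul_sq, prodExp_sum, mul_assoc 16]
    gcongr with a _
    rw [prodExp_const_mul]
    exact mul_le_mul_of_nonneg_left
      (edgeExp_linForm_update_sq_le hp0 hp1 hr (C a) e (hC1 a e) (hN a)) (sq_nonneg _)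
  refine (Finset.sum_le_sum fun e _ => hstep e).trans ?_
  rw [Finset.sum_add_distrib, ← Finset.mul_sum, Finset.sum_comm, Finset.sum_const,
    Finset.card_univ, nsmul_eq_mul]
  have h1 : ∑ a, ∑ e, C a e ^ 2 * (2 * (∑ f, C a f * (2 * p * r f)) ^ 2 + (N + 2) * p)
      ≤ N * ∑ a, (2 * (∑ e, C a e * (2 * p * r e)) ^ 2 + (N + 2) * p) := by
    rw [Finset.mul_sum]
    refine Finset.sum_le_sum fun a _ => ?_
    rw [← Finset.sum_mul]
    have hN0 : 0 ≤ N := le_trans (Finset.sum_nonneg fun e _ => sq_nonneg _) (hN a)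
    exact mul_le_mul_of_nonneg_right (hN a) (by positivity)
  have h2 := mul_le_mul_of_nonneg_left h1 (by positivity : 0 ≤ 16 * p)
  linarith

end Forms

/-! ### Oriented graphs as families of independent edges -/

/-- The edge variables of an oriented graph, one for each pair `i < j`. -/
def edgeVec {n : ℕ} (Y : OrientedGraph n) : pairs n → SignType :=
  fun e => Y.1 e.1.1 e.1.2

lemma mem_pairs {n : ℕ} {e : Fin n × Fin n} : e ∈ pairs n ↔ e.1 < e.2 := by
  simp [pairs]

lemma OrientedGraph.diag {n : ℕ} (Y : OrientedGraph n) (i : Fin n) : Y.1 i i = 0 := by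
  have h := Y.2 i i
  revert h
  generalize Y.1 i i = y
  revert y
  decide

lemma edgeVec_bijective (n : ℕ) : Function.Bijective (edgeVec (n := n)) := by
  constructor
  · intro Y Z h
    have hlt : ∀ i j, i < j → Y.1 i j = Z.1 i j := fun i j hij =>
      congrFun h ⟨(i, j), mem_pairs.2 hij⟩
    apply Subtype.ext
    ext i j
    rcases lt_trichotomy i j with hij | hij | hij
    · rw [hlt i j hij]
    · subst hij
      rw [Y.diag, Z.diag]
    · rw [Y.2 j i, Z.2 j i, hlt j i hij]
  · intro ω
    refine ⟨⟨fun i j => if h : i < j then ω ⟨(i, j), mem_pairs.2 h⟩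
      else if h : j < i then -ω ⟨(j, i), mem_pairs.2 h⟩ else 0, fun i j => ?_⟩, ?_⟩
    · rcases lt_trichotomy i j with hij | hij | hij
      · simp [hij, not_lt.2 hij.le]
      · subst hij; simp
      · simp [hij, not_lt.2 hij.le]
    · funext e
      have h := mem_pairs.1 e.2
      simp [edgeVec, h]

/-- Summing against a product of edge masses is an expectation over independent edges. -/
lemma sum_prod_edgeMass {n : ℕ} (p : ℝ) (b : Fin n → Fin n → ℝ) (f : (pairs n → SignType) → ℝ) :
    ∑ Y : OrientedGraph n, (∏ e ∈ pairs n, edgeMass p (b e.1 e.2) (Y.1 e.1 e.2)) * f (edgeVec Y)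
      = edgeExp p (fun e : pairs n => b e.1.1 e.1.2) f := by
  unfold edgeExp prodExp
  rw [← Function.Bijective.sum_comp (edgeVec_bijective n)]
  refine Finset.sum_congr rfl fun Y _ => ?_
  congr 1
  exact (Finset.prod_coe_sort (pairs n) (fun e => edgeMass p (b e.1 e.2) (Y.1 e.1 e.2))).symm

lemma abs_bias_le {n : ℕ} {q : ℝ} (hq : 0 ≤ q) (S : Finset (Fin n))
    (π : Equiv.Perm {x : Fin n // x ∈ S}) (i j : Fin n) : |bias q S π i j| ≤ q := by
  unfold bias
  split_ifs
  · exact (abs_of_nonneg hq).le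
  · rw [abs_neg]; exact (abs_of_nonneg hq).le
  · simpa using hq

lemma edgeExp_indicator_le_one {ι : Type*} [Fintype ι] [DecidableEq ι] {p : ℝ} {r : ι → ℝ}
    (hp0 : 0 ≤ p) (hp1 : p ≤ 1) (hr : ∀ e, |r e| ≤ 1 / 2) (P : (ι → SignType) → Prop)
    [DecidablePred P] : edgeExp p r (fun ω => if P ω then 1 else 0) ≤ 1 := by
  have hw1 : ∀ e, ∑ y, edgeMass p (r e) y = 1 := fun e => sum_edgeMass p (r e)
  have hw0 : ∀ e y, 0 ≤ edgeMass p (r e) y := fun e y => edgeMass_nonneg hp0 hp1 (hr e) y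
  refine (prodExp_mono hw0 (g := fun _ => 1) fun ω => ?_).trans (prodExp_const hw1 1).le
  split_ifs <;> norm_num

/-! ### The size of the community -/

lemma communityMass_nonneg {n : ℕ} {k : ℝ} (hk0 : 0 ≤ k) (hkn : k ≤ n) (S : Finset (Fin n)) :
    0 ≤ communityMass n k S := by
  have h : k / n ≤ 1 := div_le_one_of_le₀ hkn (Nat.cast_nonneg n)
  exact mul_nonneg (pow_nonneg (by positivity) _) (pow_nonneg (by linarith) _)

/-- The probability generating function of the size of the community. -/
lemma sum_communityMass_mul_pow (n : ℕ) (k c : ℝ) :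
    ∑ S : Finset (Fin n), communityMass n k S * c ^ S.card = (1 + k / n * (c - 1)) ^ n := by
  have h := Fintype.sum_pow_mul_eq_add_pow (Fin n) (k / n * c) (1 - k / n)
  rw [Fintype.card_fin] at h
  rw [show (1 + k / n * (c - 1)) = k / n * c + (1 - k / n) by ring, ← h]
  refine Finset.sum_congr rfl fun S _ => ?_
  rw [communityMass, mul_pow]
  ring

lemma sum_communityMass (n : ℕ) (k : ℝ) : ∑ S : Finset (Fin n), communityMass n k S = 1 := by
  have := sum_communityMass_mul_pow n k 1
  simpa using this

lemma one_add_div_pow_le {n : ℕ} {x : ℝ} (hx : -n ≤ x) : (1 + x / n) ^ n ≤ Real.exp x := by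
  rcases Nat.eq_zero_or_pos n with rfl | hn
  · simp at hx ⊢; exact hx
  have hn' : (0 : ℝ) < n := by exact_mod_cast hn
  have h0 : 0 ≤ 1 + x / n := by
    have : -1 ≤ x / n := by rw [le_div_iff₀ hn']; linarith
    linarith
  calc (1 + x / n) ^ n ≤ Real.exp (x / n) ^ n := by
        refine pow_le_pow_left₀ h0 ?_ n
        linarith [Real.add_one_le_exp (x / n)]
    _ = Real.exp x := by rw [← Real.exp_nat_mul]; congr 1; field_simp

lemma sum_communityMass_small_le {n : ℕ} {k : ℝ} (hk0 : 0 ≤ k) (hkn : k ≤ n) :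
    ∑ S : Finset (Fin n), (if (S.card : ℝ) < k / 2 then communityMass n k S else 0)
      ≤ Real.exp (-(k / 10)) := by
  have he : Real.exp (-1) < 2 / 5 := by
    have := Real.exp_neg_one_lt_d9; linarith
  calc ∑ S : Finset (Fin n), (if (S.card : ℝ) < k / 2 then communityMass n k S else 0)
      ≤ ∑ S : Finset (Fin n),
          Real.exp (k / 2) * (communityMass n k S * Real.exp (-1) ^ S.card) := by
        refine Finset.sum_le_sum fun S _ => ?_
        have hm := communityMass_nonneg hk0 hkn S
        rw [← Real.exp_nat_mul]
        split_ifs with h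
        · have : 1 ≤ Real.exp (k / 2) * Real.exp (S.card * -1) := by
            rw [← Real.exp_add]; exact Real.one_le_exp (by linarith)
          nlinarith
        · positivity
    _ = Real.exp (k / 2) * (1 + (k * (Real.exp (-1) - 1)) / n) ^ n := by
        rw [← Finset.mul_sum, sum_communityMass_mul_pow]
        congr 3; ring
    _ ≤ Real.exp (k / 2) * Real.exp (k * (Real.exp (-1) - 1)) := by
        refine mul_le_mul_of_nonneg_left (one_add_div_pow_le ?_) (Real.exp_pos _).le
        nlinarith [Real.exp_pos (-1)]
    _ ≤ Real.exp (-(k / 10)) := by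
        rw [← Real.exp_add]
        refine Real.exp_le_exp.2 ?_
        nlinarith

lemma sum_communityMass_large_le {n : ℕ} {k : ℝ} (hk0 : 0 ≤ k) (hkn : k ≤ n) :
    ∑ S : Finset (Fin n), (if 2 * k < (S.card : ℝ) then communityMass n k S else 0)
      ≤ Real.exp (-(k / 10)) := by
  have he : Real.exp 1 < 2.8 := by
    have := Real.exp_one_lt_d9; linarith
  calc ∑ S : Finset (Fin n), (if 2 * k < (S.card : ℝ) then communityMass n k S else 0)
      ≤ ∑ S : Finset (Fin n),
          Real.exp (-(2 * k)) * (communityMass n k S * Real.exp 1 ^ S.card) := by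
        refine Finset.sum_le_sum fun S _ => ?_
        have hm := communityMass_nonneg hk0 hkn S
        rw [← Real.exp_nat_mul]
        split_ifs with h
        · have : 1 ≤ Real.exp (-(2 * k)) * Real.exp (S.card * 1) := by
            rw [← Real.exp_add]; exact Real.one_le_exp (by linarith)
          nlinarith
        · positivity
    _ = Real.exp (-(2 * k)) * (1 + (k * (Real.exp 1 - 1)) / n) ^ n := by
        rw [← Finset.mul_sum, sum_communityMass_mul_pow]
        congr 3; ring
    _ ≤ Real.exp (-(2 * k)) * Real.exp (k * (Real.exp 1 - 1)) := by
        refine mul_le_mul_of_nonneg_left (one_add_div_pow_le ?_) (Real.exp_pos _).le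
        nlinarith [Real.add_one_le_exp 1]
    _ ≤ Real.exp (-(k / 10)) := by
        rw [← Real.exp_add]
        refine Real.exp_le_exp.2 ?_
        nlinarith

/-! ### Error probabilities of a test given through the edge variables -/

section Errors

variable {n : ℕ} {p k q : ℝ}

lemma nullMass_nonneg (hp0 : 0 ≤ p) (hp1 : p ≤ 1) (Y : OrientedGraph n) : 0 ≤ nullMass n p Y :=
  Finset.prod_nonneg fun _ _ => edgeMass_nonneg hp0 hp1 (by norm_num) _

lemma condMass_nonneg (hp0 : 0 ≤ p) (hp1 : p ≤ 1) (hq0 : 0 ≤ q) (hq1 : q ≤ 1 / 2)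
    (S : Finset (Fin n)) (π : Equiv.Perm {x : Fin n // x ∈ S}) (Y : OrientedGraph n) :
    0 ≤ condMass p q S π Y :=
  Finset.prod_nonneg fun _ _ =>
    edgeMass_nonneg hp0 hp1 ((abs_bias_le hq0 S π _ _).trans hq1) _

lemma plantedMass_nonneg (hp0 : 0 ≤ p) (hp1 : p ≤ 1) (hk0 : 0 ≤ k) (hkn : k ≤ n)
    (hq0 : 0 ≤ q) (hq1 : q ≤ 1 / 2) (Y : OrientedGraph n) : 0 ≤ plantedMass n p k q Y :=
  Finset.sum_nonneg fun S _ => mul_nonneg (communityMass_nonneg hk0 hkn S) <|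
    Finset.sum_nonneg fun π _ =>
      mul_nonneg (by positivity) (condMass_nonneg hp0 hp1 hq0 hq1 S π Y)

lemma sum_nullMass_filter (P : (pairs n → SignType) → Prop) [DecidablePred P] :
    ∑ Y ∈ Finset.univ.filter (fun Y : OrientedGraph n => decide (P (edgeVec Y)) = true),
      nullMass n p Y = edgeExp p (fun _ : pairs n => 0) (fun ω => if P ω then 1 else 0) := by
  rw [← sum_prod_edgeMass p (fun _ _ => 0), Finset.sum_filter]
  refine Finset.sum_congr rfl fun Y _ => ?_
  simp [nullMass]

/-- It suffices to control the error of a test conditionally on the ranked community, and only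
for communities with at least `k / 2` members. -/
lemma sum_plantedMass_filter_le (hp0 : 0 ≤ p) (hp1 : p ≤ 1) (hk0 : 0 ≤ k) (hkn : k ≤ n)
    (hq0 : 0 ≤ q) (hq1 : q ≤ 1 / 2) (P : (pairs n → SignType) → Prop) [DecidablePred P] {ε : ℝ}
    (hε0 : 0 ≤ ε)
    (hε : ∀ (S : Finset (Fin n)) (π : Equiv.Perm {x : Fin n // x ∈ S}), k / 2 ≤ (S.card : ℝ) →
      edgeExp p (fun e : pairs n => bias q S π e.1.1 e.1.2) (fun ω => if P ω then 0 else 1) ≤ ε) :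
    ∑ Y ∈ Finset.univ.filter (fun Y : OrientedGraph n => decide (P (edgeVec Y)) = false),
      plantedMass n p k q Y ≤ Real.exp (-(k / 10)) + ε := by
  have h1 : ∑ Y ∈ Finset.univ.filter (fun Y : OrientedGraph n => decide (P (edgeVec Y)) = false),
      plantedMass n p k q Y
      = ∑ S : Finset (Fin n), communityMass n k S * ∑ π : Equiv.Perm {x : Fin n // x ∈ S},
        (1 / (S.card.factorial : ℝ)) * edgeExp p (fun e : pairs n => bias q S π e.1.1 e.1.2)
          (fun ω => if P ω then 0 else 1) := by
    unfold plantedMass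
    rw [Finset.sum_comm]
    refine Finset.sum_congr rfl fun S _ => ?_
    rw [← Finset.mul_sum, Finset.sum_comm]
    congr 1
    refine Finset.sum_congr rfl fun π _ => ?_
    rw [← Finset.mul_sum, ← sum_prod_edgeMass p (bias q S π), Finset.sum_filter]
    congr 1
    refine Finset.sum_congr rfl fun Y _ => ?_
    by_cases h : P (edgeVec Y) <;> simp [h, condMass]
  rw [h1]
  have hb : ∀ (S : Finset (Fin n)) (π : Equiv.Perm {x : Fin n // x ∈ S}),
      ∀ e : pairs n, |bias q S π e.1.1 e.1.2| ≤ 1 / 2 := fun S π e =>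
    (abs_bias_le hq0 S π _ _).trans hq1
  have hone : ∀ (S : Finset (Fin n)) (π : Equiv.Perm {x : Fin n // x ∈ S}),
      edgeExp p (fun e : pairs n => bias q S π e.1.1 e.1.2) (fun ω => if P ω then 0 else 1)
        ≤ 1 := by
    intro S π
    have := edgeExp_indicator_le_one hp0 hp1 (hb S π) (fun ω => ¬ P ω)
    simpa only [ite_not] using this
  -- the average over the orderings of the community is at most the bound for a single ordering
  have havg : ∀ (S : Finset (Fin n)) (c : ℝ),
      (∀ π : Equiv.Perm {x : Fin n // x ∈ S}, edgeExp p (fun e : pairs n => bias q S π e.1.1 e.1.2)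
        (fun ω => if P ω then 0 else 1) ≤ c) →
      ∑ π : Equiv.Perm {x : Fin n // x ∈ S}, (1 / (S.card.factorial : ℝ))
        * edgeExp p (fun e : pairs n => bias q S π e.1.1 e.1.2)
          (fun ω => if P ω then 0 else 1) ≤ c := by
    intro S c hc
    rw [← Finset.mul_sum]
    have hcard : Fintype.card (Equiv.Perm {x : Fin n // x ∈ S}) = S.card.factorial := by
      rw [Fintype.card_perm, Fintype.card_coe]
    have hpos : (0 : ℝ) < S.card.factorial := by exact_mod_cast Nat.factorial_pos _
    have h := Finset.sum_le_sum (s := Finset.univ) fun π _ => hc π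
    rw [Finset.sum_const, Finset.card_univ, hcard, nsmul_eq_mul] at h
    rw [one_div, inv_mul_le_iff₀ hpos]
    exact h
  calc _ ≤ ∑ S : Finset (Fin n), ((if (S.card : ℝ) < k / 2 then communityMass n k S else 0)
        + communityMass n k S * ε) := by
        refine Finset.sum_le_sum fun S _ => ?_
        have hm := communityMass_nonneg hk0 hkn S
        split_ifs with h
        · have := mul_le_mul_of_nonneg_left (havg S 1 (hone S)) hm
          nlinarith
        · have := mul_le_mul_of_nonneg_left
            (havg S ε (fun π => hε S π (not_lt.1 h))) hm
          linarith
    _ ≤ Real.exp (-(k / 10)) + ε := by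
        rw [Finset.sum_add_distrib, ← Finset.sum_mul, sum_communityMass, one_mul]
        linarith [sum_communityMass_small_le hk0 hkn]

end Errors

/-! ### The scan test -/

lemma bias_eq_mul {n : ℕ} (q : ℝ) (S : Finset (Fin n)) (π : Equiv.Perm {x : Fin n // x ∈ S})
    (i j : Fin n) : bias q S π i j = q * bias 1 S π i j := by
  unfold bias
  split_ifs <;> ring

lemma bias_one_sq {n : ℕ} (S : Finset (Fin n)) (π : Equiv.Perm {x : Fin n // x ∈ S})
    (i j : Fin n) : bias 1 S π i j ^ 2 = if i ∈ S ∧ j ∈ S then 1 else 0 := by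
  unfold bias
  split_ifs <;> norm_num

/-- A symmetric double sum is its diagonal plus twice the sum over pairs. -/
lemma sum_sum_eq_diag_add_two_mul {n : ℕ} (h : Fin n → Fin n → ℝ) (hs : ∀ i j, h i j = h j i) :
    ∑ i, ∑ j, h i j = ∑ i, h i i + 2 * ∑ e : pairs n, h e.1.1 e.1.2 := by
  have h1 : ∑ e : pairs n, h e.1.1 e.1.2 = ∑ i, ∑ j, if i < j then h i j else 0 := by
    rw [Finset.sum_coe_sort (pairs n) (fun e => h e.1 e.2), pairs, Finset.sum_filter,
      Fintype.sum_prod_type]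
  have h2 : ∑ i, ∑ j, (if i < j then h i j else 0) = ∑ i, ∑ j, if j < i then h i j else 0 := by
    rw [Finset.sum_comm]
    refine Finset.sum_congr rfl fun i _ => Finset.sum_congr rfl fun j _ => ?_
    rw [hs]
  have h3 : ∑ i, h i i = ∑ i, ∑ j, if i = j then h i j else 0 := by simp
  rw [two_mul, h1]
  nth_rw 2 [h2]
  rw [h3, ← Finset.sum_add_distrib, ← Finset.sum_add_distrib]
  refine Finset.sum_congr rfl fun i _ => ?_
  rw [← Finset.sum_add_distrib, ← Finset.sum_add_distrib]
  refine Finset.sum_congr rfl fun j _ => ?_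
  rcases lt_trichotomy i j with hij | hij | hij
  · simp [hij, hij.ne, not_lt.2 hij.le]
  · subst hij; simp
  · simp [hij, hij.ne', not_lt.2 hij.le]

lemma sum_bias_one_sq {n : ℕ} (S : Finset (Fin n)) (π : Equiv.Perm {x : Fin n // x ∈ S}) :
    ∑ e : pairs n, bias 1 S π e.1.1 e.1.2 ^ 2 = (S.card : ℝ) * (S.card - 1) / 2 := by
  simp only [bias_one_sq]
  have h := sum_sum_eq_diag_add_two_mul
    (fun i j : Fin n => if i ∈ S ∧ j ∈ S then (1 : ℝ) else 0)
    (fun i j => by simp only [and_comm])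
  have h1 : ∑ i : Fin n, ∑ j : Fin n, (if i ∈ S ∧ j ∈ S then (1 : ℝ) else 0)
      = (S.card : ℝ) * S.card := by
    simp only [ite_and, Finset.sum_ite_mem, Finset.univ_inter, Finset.sum_ite_irrel,
      Finset.sum_const, nsmul_eq_mul, mul_one, mul_zero]
  have h2 : ∑ i : Fin n, (if i ∈ S ∧ i ∈ S then (1 : ℝ) else 0) = S.card := by
    simp
  rw [h1, h2] at h
  linarith

lemma sum_edgeMass_mul_exp_le {p : ℝ} (hp0 : 0 ≤ p) {x : ℝ} (hx : x ^ 2 ≤ 1) :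
    ∑ y : SignType, edgeMass p 0 y * Real.exp (x * (y : ℝ)) ≤ Real.exp (p * x ^ 2) := by
  have h1 : ∑ y : SignType, edgeMass p 0 y * Real.exp (x * (y : ℝ))
      = 1 + p * (Real.cosh x - 1) := by
    rw [sum_signType, edgeMass_zero, edgeMass_one, edgeMass_neg_one, Real.cosh_eq]
    simp
    ring
  have h2 := Real.cosh_le_exp_half_sq x
  have h3 := Real.abs_exp_sub_one_le (x := x ^ 2 / 2)
    (by rw [abs_of_nonneg (by positivity)]; linarith)
  rw [abs_of_nonneg (by positivity : 0 ≤ x ^ 2 / 2)] at h3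
  have h4 := (abs_le.1 h3).2
  have h5 : p * (Real.cosh x - 1) ≤ p * x ^ 2 :=
    mul_le_mul_of_nonneg_left (by linarith) hp0
  rw [h1]
  linarith [Real.add_one_le_exp (p * x ^ 2)]

/-- Chernoff's bound for a linear statistic under the null model. -/
lemma edgeExp_zero_indicator_le {ι : Type*} [Fintype ι] [DecidableEq ι] {p : ℝ} (hp0 : 0 ≤ p)
    (hp1 : p ≤ 1) (c : ι → ℝ) (hc : ∀ e, c e ^ 2 ≤ 1) {θ t : ℝ} (hθ0 : 0 ≤ θ) (hθ1 : θ ≤ 1)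
    (P : (ι → SignType) → Prop) [DecidablePred P] (hP : ∀ ω, P ω → t ≤ linForm c ω) :
    edgeExp p (fun _ => 0) (fun ω => if P ω then 1 else 0)
      ≤ Real.exp (-(θ * t) + p * θ ^ 2 * ∑ e, c e ^ 2) := by
  have hw0 : ∀ (_ : ι) y, 0 ≤ edgeMass p 0 y := fun _ y => edgeMass_nonneg hp0 hp1 (by norm_num) y
  calc edgeExp p (fun _ => 0) (fun ω => if P ω then 1 else 0)
      ≤ edgeExp p (fun _ => 0)
        (fun ω => Real.exp (-(θ * t)) * ∏ e, Real.exp (θ * c e * (ω e : ℝ))) := by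
        refine prodExp_mono hw0 fun ω => ?_
        rw [← Real.exp_sum, ← Real.exp_add]
        split_ifs with h
        · refine Real.one_le_exp ?_
          have := mul_le_mul_of_nonneg_left (hP ω h) hθ0
          have e1 : ∑ e, θ * c e * (ω e : ℝ) = θ * linForm c ω := by
            rw [linForm, Finset.mul_sum]
            exact Finset.sum_congr rfl fun e _ => by ring
          rw [e1]; linarith
        · positivity
    _ = Real.exp (-(θ * t)) *
          ∏ e, ∑ y : SignType, edgeMass p 0 y * Real.exp (θ * c e * (y : ℝ)) := by
        unfold edgeExp
        rw [prodExp_const_mul]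
        congr 1
        exact prodExp_prod (fun e (y : SignType) => Real.exp (θ * c e * (y : ℝ)))
    _ ≤ Real.exp (-(θ * t)) * ∏ e, Real.exp (p * (θ * c e) ^ 2) := by
        refine mul_le_mul_of_nonneg_left (Finset.prod_le_prod (fun e _ => ?_) fun e _ => ?_)
          (Real.exp_pos _).le
        · exact Finset.sum_nonneg fun y _ => mul_nonneg (hw0 e y) (Real.exp_pos _).le
        · refine sum_edgeMass_mul_exp_le hp0 ?_
          rw [mul_pow]
          exact mul_le_one₀ (pow_le_one₀ hθ0 hθ1) (sq_nonneg _) (hc e)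
    _ = _ := by
        rw [← Real.exp_sum, ← Real.exp_add, Finset.mul_sum]
        congr 2
        exact Finset.sum_congr rfl fun e _ => by ring

section Scan

variable {n : ℕ} {p k q : ℝ}

/-- The number of edges agreeing with the ranking `π` of `S`, minus the number of edges that
disagree with it. -/
noncomputable def agreement {n : ℕ} (S : Finset (Fin n)) (π : Equiv.Perm {x : Fin n // x ∈ S}) :
    (pairs n → SignType) → ℝ :=
  linForm fun e => bias 1 S π e.1.1 e.1.2

/-- Some ranked set with at least `k / 2` elements has at least half the agreement that is expected
from a planted ranked community. -/
def ScanEvent (n : ℕ) (p k q : ℝ) (ω : pairs n → SignType) : Prop :=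
  ∃ (S : Finset (Fin n)) (π : Equiv.Perm {x : Fin n // x ∈ S}), k / 2 ≤ (S.card : ℝ) ∧
    p * q * ((S.card : ℝ) * (S.card - 1) / 2) ≤ agreement S π ω

open Classical in
lemma scan_planted_le (hp0 : 0 < p) (hp1 : p ≤ 1) (hk : 4 ≤ k) (hq0 : 0 < q) (hq1 : q ≤ 1 / 2)
    (S : Finset (Fin n)) (π : Equiv.Perm {x : Fin n // x ∈ S}) (hS : k / 2 ≤ (S.card : ℝ)) :
    edgeExp p (fun e : pairs n => bias q S π e.1.1 e.1.2)
      (fun ω => if ScanEvent n p k q ω then 0 else 1) ≤ 16 / (p * q ^ 2 * k ^ 2) := by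
  set m : ℝ := (S.card : ℝ)
  set N : ℝ := m * (m - 1) / 2 with hN
  have hNk : k ^ 2 / 16 ≤ N := by rw [hN]; nlinarith
  have hN0 : 0 < N := by nlinarith
  have hr : ∀ e : pairs n, |bias q S π e.1.1 e.1.2| ≤ 1 / 2 := fun e =>
    (abs_bias_le hq0.le S π _ _).trans hq1
  have hw0 : ∀ (e : pairs n) y, 0 ≤ edgeMass p (bias q S π e.1.1 e.1.2) y := fun e y =>
    edgeMass_nonneg hp0.le hp1 (hr e) y
  have hsum : ∑ e : pairs n, bias 1 S π e.1.1 e.1.2 ^ 2 = N := sum_bias_one_sq S π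
  have hmean : edgeExp p (fun e : pairs n => bias q S π e.1.1 e.1.2) (agreement S π)
      = 2 * p * q * N := by
    rw [agreement, edgeExp_linForm, ← hsum, Finset.mul_sum]
    refine Finset.sum_congr rfl fun e _ => ?_
    rw [bias_eq_mul q]; ring
  have hvar : edgeExp p (fun e : pairs n => bias q S π e.1.1 e.1.2)
      (fun ω => (agreement S π ω - 2 * p * q * N) ^ 2) ≤ p * N := by
    rw [← hmean, agreement, edgeExp_linForm_sub_sq, ← hsum, Finset.mul_sum]
    refine Finset.sum_le_sum fun e _ => ?_
    have := mul_nonneg (sq_nonneg (bias 1 S π e.1.1 e.1.2))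
      (sq_nonneg (2 * p * bias q S π e.1.1 e.1.2))
    linarith
  have hcheb := prodExp_indicator_le hw0 (agreement S π) (2 * p * q * N) (t := p * q * N)
    (by positivity) (fun ω => ¬ ScanEvent n p k q ω) (fun ω hω => by
      have h : agreement S π ω < p * q * N := by
        by_contra h
        exact hω ⟨S, π, hS, not_lt.1 h⟩
      rw [abs_of_neg (by nlinarith [mul_pos (mul_pos hp0 hq0) hN0])]
      linarith)
  simp only [ite_not] at hcheb
  refine hcheb.trans ((div_le_div_of_nonneg_right hvar (by positivity)).trans ?_)
  have : p * N / (p * q * N) ^ 2 = 1 / (p * q ^ 2 * N) := by field_simp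
  rw [this, div_le_div_iff₀ (by positivity) (by positivity)]
  have h2 := mul_le_mul_of_nonneg_left hNk (by positivity : 0 ≤ p * q ^ 2)
  linarith

open Classical in
/-- The union bound over all ranked sets: there are at most `n ^ m` of size `m`. -/
lemma scan_null_le (hp0 : 0 < p) (hp1 : p ≤ 1) (hk : 4 ≤ k) (hq0 : 0 < q) (hq1 : q ≤ 1 / 2)
    (hs : n * Real.exp (-(p * q ^ 2 * k / 32)) ≤ 1) :
    edgeExp p (fun _ : pairs n => 0) (fun ω => if ScanEvent n p k q ω then 1 else 0)
      ≤ (n + 1) * (n * Real.exp (-(p * q ^ 2 * k / 32))) := by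
  set s := p * q ^ 2 * k / 32 with hsdef
  have hw0 : ∀ (_ : pairs n) y, 0 ≤ edgeMass p 0 y := fun _ y =>
    edgeMass_nonneg hp0.le hp1 (by norm_num) y
  let A : (S : Finset (Fin n)) → Equiv.Perm {x : Fin n // x ∈ S} → (pairs n → SignType) → Prop :=
    fun S π ω => k / 2 ≤ (S.card : ℝ) ∧
      p * q * ((S.card : ℝ) * (S.card - 1) / 2) ≤ agreement S π ω
  have h1 : edgeExp p (fun _ : pairs n => 0) (fun ω => if ScanEvent n p k q ω then 1 else 0)
      ≤ ∑ S : Finset (Fin n), ∑ π : Equiv.Perm {x : Fin n // x ∈ S},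
        edgeExp p (fun _ : pairs n => 0) (fun ω => if A S π ω then 1 else 0) := by
    unfold edgeExp
    simp only [← prodExp_sum]
    refine prodExp_mono hw0 fun ω => ?_
    have hnn : ∀ (S : Finset (Fin n)) (π : Equiv.Perm {x : Fin n // x ∈ S}),
        (0 : ℝ) ≤ if A S π ω then 1 else 0 := fun S π => by split_ifs <;> norm_num
    split_ifs with h
    · obtain ⟨S, π, hS⟩ := h
      have hA : A S π ω := hS
      calc (1 : ℝ) = if A S π ω then 1 else 0 := by rw [if_pos hA]
        _ ≤ ∑ π : Equiv.Perm {x : Fin n // x ∈ S}, if A S π ω then (1 : ℝ) else 0 :=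
          Finset.single_le_sum (f := fun π => if A S π ω then (1 : ℝ) else 0)
            (fun π _ => hnn S π) (Finset.mem_univ π)
        _ ≤ _ := Finset.single_le_sum
            (f := fun S => ∑ π : Equiv.Perm {x : Fin n // x ∈ S}, if A S π ω then (1 : ℝ) else 0)
            (fun S _ => Finset.sum_nonneg fun π _ => hnn S π) (Finset.mem_univ S)
    · exact Finset.sum_nonneg fun S _ => Finset.sum_nonneg fun π _ => hnn S π
  have h2 : ∀ (S : Finset (Fin n)) (π : Equiv.Perm {x : Fin n // x ∈ S}),
      edgeExp p (fun _ : pairs n => 0) (fun ω => if A S π ω then 1 else 0)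
        ≤ if k / 2 ≤ (S.card : ℝ) then Real.exp (-s) ^ S.card else 0 := by
    intro S π
    split_ifs with hS
    · -- `θ = q / 2` minimizes the exponent `-(θ * (p * q * N)) + p * θ ^ 2 * N`
      refine (edgeExp_zero_indicator_le hp0.le hp1 (fun e : pairs n => bias 1 S π e.1.1 e.1.2)
        (fun e => by rw [bias_one_sq]; split_ifs <;> norm_num) (θ := q / 2) (by linarith)
        (by linarith) (A S π) (fun ω hω => hω.2)).trans ?_
      rw [sum_bias_one_sq, ← Real.exp_nat_mul]
      refine Real.exp_le_exp.2 ?_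
      set m : ℝ := (S.card : ℝ)
      have hm : m * (k / 8) ≤ m * (m - 1) / 2 := by nlinarith
      have := mul_le_mul_of_nonneg_left hm (by positivity : 0 ≤ p * q ^ 2 / 4)
      rw [hsdef]
      linarith
    · have : ∀ ω, ¬ A S π ω := fun ω h => hS h.1
      simp [this, edgeExp, prodExp]
  have h3 : ∀ S : Finset (Fin n), ∑ π : Equiv.Perm {x : Fin n // x ∈ S},
      edgeExp p (fun _ : pairs n => 0) (fun ω => if A S π ω then 1 else 0)
        ≤ if k / 2 ≤ (S.card : ℝ) then (S.card.factorial : ℝ) * Real.exp (-s) ^ S.card else 0 := by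
    intro S
    refine (Finset.sum_le_sum fun π _ => h2 S π).trans ?_
    rw [Finset.sum_const, Finset.card_univ, Fintype.card_perm, Fintype.card_coe, nsmul_eq_mul,
      mul_ite, mul_zero]
  refine (h1.trans (Finset.sum_le_sum fun S _ => h3 S)).trans ?_
  have h4 := Finset.sum_powerset_apply_card (x := (Finset.univ : Finset (Fin n)))
    (fun m : ℕ => if k / 2 ≤ (m : ℝ) then (m.factorial : ℝ) * Real.exp (-s) ^ m else 0)
  rw [Finset.powerset_univ, Finset.card_univ, Fintype.card_fin] at h4
  rw [h4]
  have h5 : ∀ m ∈ Finset.range (n + 1),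
      n.choose m • (if k / 2 ≤ (m : ℝ) then (m.factorial : ℝ) * Real.exp (-s) ^ m else 0)
        ≤ n * Real.exp (-s) := by
    intro m _
    split_ifs with hm
    · have hm1 : m ≠ 0 := by
        rintro rfl
        norm_num at hm; linarith
      have hd : (n.choose m : ℝ) * m.factorial ≤ (n : ℝ) ^ m := by
        have : m.factorial * n.choose m ≤ n ^ m := by
          rw [← Nat.descFactorial_eq_factorial_mul_choose]; exact Nat.descFactorial_le_pow n m
        rw [mul_comm]; exact_mod_cast this
      calc n.choose m • ((m.factorial : ℝ) * Real.exp (-s) ^ m)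
          = ((n.choose m : ℝ) * m.factorial) * Real.exp (-s) ^ m := by
            rw [nsmul_eq_mul, mul_assoc]
        _ ≤ (n : ℝ) ^ m * Real.exp (-s) ^ m :=
            mul_le_mul_of_nonneg_right hd (by positivity)
        _ = (n * Real.exp (-s)) ^ m := by rw [mul_pow]
        _ ≤ n * Real.exp (-s) := pow_le_of_le_one (by positivity) hs hm1
    · rw [nsmul_zero]; positivity
  refine (Finset.sum_le_sum h5).trans ?_
  rw [Finset.sum_const, Finset.card_range, nsmul_eq_mul]
  push_cast
  exact le_rfl

end Scan

/-! ### Comparison signs of a linear order -/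

/-- The sign of `y - x` in a linear order. -/
def ordSign {A : Type*} [LinearOrder A] (x y : A) : ℝ :=
  if x < y then 1 else if y < x then -1 else 0

section OrdSign

variable {A : Type*} [LinearOrder A]

lemma ordSign_self (x : A) : ordSign x x = 0 := by simp [ordSign]

lemma ordSign_swap (x y : A) : ordSign y x = -ordSign x y := by
  unfold ordSign
  rcases lt_trichotomy x y with h | h | h
  · simp [h, not_lt.2 h.le]
  · simp [h]
  · simp [h, not_lt.2 h.le]

lemma ordSign_of_lt {x y : A} (h : x < y) : ordSign x y = 1 := by simp [ordSign, h]

lemma ordSign_congr {B : Type*} [LinearOrder B] {x y : A} {u v : B} (h1 : x < y ↔ u < v)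
    (h2 : y < x ↔ v < u) : ordSign x y = ordSign u v := by
  simp only [ordSign, h1, h2]

end OrdSign

/-- The comparison sign of `i` and `j` in the ranking `π` of `S`, zero off `S` and on the
diagonal. -/
def rankSign {n : ℕ} (S : Finset (Fin n)) (π : Equiv.Perm {x : Fin n // x ∈ S})
    (i j : Fin n) : ℝ :=
  if h : i ∈ S ∧ j ∈ S then ordSign (π ⟨i, h.1⟩) (π ⟨j, h.2⟩) else 0

lemma rankSign_swap {n : ℕ} (S : Finset (Fin n)) (π : Equiv.Perm {x : Fin n // x ∈ S})
    (i j : Fin n) : rankSign S π j i = -rankSign S π i j := by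
  unfold rankSign
  by_cases h : i ∈ S ∧ j ∈ S
  · rw [dif_pos h, dif_pos h.symm, ordSign_swap]
  · rw [dif_neg h, dif_neg (fun h' => h h'.symm), neg_zero]

lemma bias_eq_mul_rankSign {n : ℕ} (q : ℝ) (S : Finset (Fin n))
    (π : Equiv.Perm {x : Fin n // x ∈ S}) {i j : Fin n} (hij : i ≠ j) :
    bias q S π i j = q * rankSign S π i j := by
  unfold bias rankSign
  by_cases h : i ∈ S ∧ j ∈ S
  · rw [dif_pos h, dif_pos h]
    have hne : π ⟨i, h.1⟩ ≠ π ⟨j, h.2⟩ := fun hh => hij (by simpa using π.injective hh)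
    rcases lt_or_gt_of_ne hne with hlt | hlt
    · simp [ordSign, hlt]
    · simp [ordSign, hlt, not_lt.2 hlt.le]
  · rw [dif_neg h, dif_neg h, mul_zero]

lemma sum_ordSign_fin (m : ℕ) (i : Fin m) :
    ∑ j : Fin m, ordSign i j = (m : ℝ) - 1 - 2 * (i : ℕ) := by
  have h1 : ∀ j : Fin m, ordSign i j
      = 1 - (if j = i then 1 else 0) - 2 * (if j < i then 1 else 0) := by
    intro j
    unfold ordSign
    rcases lt_trichotomy i j with h | h | h
    · simp [h, h.ne', not_lt.2 h.le]
    · simp [h]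
    · simp [h, h.ne, not_lt.2 h.le]; norm_num
  simp only [h1, Finset.sum_sub_distrib, ← Finset.mul_sum, Finset.sum_ite_eq', Finset.mem_univ,
    if_true, Finset.sum_const, Finset.card_univ, Fintype.card_fin, nsmul_eq_mul, mul_one,
    Finset.sum_boole]
  rw [Finset.filter_gt_eq_Iio, Fin.card_Iio]

lemma sum_sq_arith (m : ℕ) :
    ∑ i ∈ Finset.range m, ((m : ℝ) - 1 - 2 * (i : ℕ)) ^ 2 = (m : ℝ) * (m ^ 2 - 1) / 3 := by
  have h : ∀ (c : ℝ) (l : ℕ), ∑ i ∈ Finset.range l, (c - 2 * (i : ℕ)) ^ 2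
      = l * c ^ 2 - 2 * c * (l * (l - 1)) + 4 * ((l - 1) * l * (2 * l - 1) / 6) := by
    intro c l
    induction l with
    | zero => simp
    | succ l ih => rw [Finset.sum_range_succ, ih]; push_cast; ring
  rw [h]; ring

lemma sum_rankSign_eq {n : ℕ} (S : Finset (Fin n)) (π : Equiv.Perm {x : Fin n // x ∈ S})
    (x : {x : Fin n // x ∈ S}) :
    ∑ j, rankSign S π x j = ∑ y : {x : Fin n // x ∈ S}, ordSign (π x) y := by
  rw [← Equiv.sum_comp π, ← Finset.sum_subset (Finset.subset_univ S), ← Finset.sum_coe_sort]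
  · refine Finset.sum_congr rfl fun y _ => ?_
    rw [rankSign, dif_pos ⟨x.2, y.2⟩]
  · intro j _ hj
    rw [rankSign, dif_neg (fun h => hj h.2)]

/-- The sum of the squared scores of a ranking does not depend on the ranking. -/
lemma sum_sum_rankSign_sq {n : ℕ} (S : Finset (Fin n)) (π : Equiv.Perm {x : Fin n // x ∈ S}) :
    ∑ i, (∑ j, rankSign S π i j) ^ 2 = (S.card : ℝ) * ((S.card : ℝ) ^ 2 - 1) / 3 := by
  have h1 : ∑ i, (∑ j, rankSign S π i j) ^ 2
      = ∑ x : {x : Fin n // x ∈ S}, (∑ y : {x : Fin n // x ∈ S}, ordSign x y) ^ 2 := by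
    rw [← Equiv.sum_comp π (fun x => (∑ y : {x : Fin n // x ∈ S}, ordSign x y) ^ 2),
      ← Finset.sum_subset (Finset.subset_univ S), ← Finset.sum_coe_sort]
    · exact Finset.sum_congr rfl fun x _ => by rw [sum_rankSign_eq]
    · intro i _ hi
      rw [Finset.sum_eq_zero]
      · norm_num
      · intro j _
        rw [rankSign, dif_neg (fun h => hi h.1)]
  let φ : Fin S.card ≃o {x : Fin n // x ∈ S} := S.orderIsoOfFin rfl
  have h2 : ∀ i j, ordSign (φ i) (φ j) = ordSign i j := fun i j =>
    ordSign_congr φ.lt_iff_lt φ.lt_iff_lt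
  rw [h1, ← sum_sq_arith, ← Equiv.sum_comp φ.toEquiv, Finset.sum_range]
  refine Finset.sum_congr rfl fun i _ => ?_
  rw [← sum_ordSign_fin, ← Equiv.sum_comp φ.toEquiv]
  congr 1
  exact Finset.sum_congr rfl fun j _ => h2 i j

/-! ### The degree test -/

/-- The coefficient of the edge variable `e` in the out-degree minus the in-degree of `a`. -/
def incidence {n : ℕ} (a : Fin n) (e : pairs n) : ℝ :=
  (if e.1.1 = a then 1 else 0) - (if e.1.2 = a then 1 else 0)

lemma pairs_ne {n : ℕ} (e : pairs n) : e.1.1 ≠ e.1.2 := (mem_pairs.1 e.2).ne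

lemma incidence_sq {n : ℕ} (a : Fin n) (e : pairs n) :
    incidence a e ^ 2 = (if e.1.1 = a then 1 else 0) + (if e.1.2 = a then 1 else 0) := by
  have h := pairs_ne e
  unfold incidence
  split_ifs with h1 h2
  · exact absurd (h1.trans h2.symm) h
  all_goals norm_num

lemma incidence_cube {n : ℕ} (a : Fin n) (e : pairs n) : incidence a e ^ 3 = incidence a e := by
  unfold incidence
  split_ifs <;> norm_num

lemma sum_incidence_sq {n : ℕ} (e : pairs n) : ∑ a, incidence a e ^ 2 = 2 := by
  simp only [incidence_sq, Finset.sum_add_distrib, Finset.sum_ite_eq, Finset.mem_univ, if_true]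
  norm_num

lemma sum_incidence_mul {n : ℕ} (a : Fin n) (g : Fin n → Fin n → ℝ) (hg : ∀ i j, g j i = -g i j) :
    ∑ e : pairs n, incidence a e * g e.1.1 e.1.2 = ∑ j, g a j := by
  have h := sum_sum_eq_diag_add_two_mul
    (fun i j => ((if i = a then (1 : ℝ) else 0) - (if j = a then 1 else 0)) * g i j)
    (fun i j => by rw [hg i j]; ring)
  have h1 : ∑ i, g i a = -∑ j, g a j := by
    rw [← Finset.sum_neg_distrib]
    exact Finset.sum_congr rfl fun i _ => hg a i
  simp only [sub_mul, ite_mul, one_mul, zero_mul, Finset.sum_sub_distrib, sub_self,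
    Finset.sum_const_zero, zero_add] at h
  simp only [Finset.sum_ite_eq', Finset.mem_univ, if_true, h1] at h
  rw [Finset.sum_comm] at h
  simp only [Finset.sum_ite_eq', Finset.mem_univ, if_true] at h
  simp only [incidence, sub_mul, ite_mul, one_mul, zero_mul, Finset.sum_sub_distrib]
  linarith

lemma sum_incidence_sq_le {n : ℕ} (a : Fin n) : ∑ e : pairs n, incidence a e ^ 2 ≤ n := by
  have h := sum_sum_eq_diag_add_two_mul
    (fun i j => ((if i = a then (1 : ℝ) else 0) + (if j = a then 1 else 0)))
    (fun i j => by ring)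
  simp only [Finset.sum_add_distrib, Finset.sum_ite_eq', Finset.mem_univ, if_true,
    Finset.sum_const, Finset.card_univ, Fintype.card_fin, nsmul_eq_mul, mul_one] at h
  rw [← Finset.mul_sum] at h
  simp only [Finset.sum_ite_eq', Finset.mem_univ, if_true] at h
  simp only [incidence_sq, Finset.sum_add_distrib]
  linarith

lemma card_pairs_le (n : ℕ) : (Fintype.card (pairs n) : ℝ) ≤ (n : ℝ) ^ 2 := by
  have h : Fintype.card (pairs n) ≤ n ^ 2 := by
    rw [Fintype.card_coe, pairs]
    refine (Finset.card_filter_le _ _).trans ?_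
    rw [Finset.card_univ, Fintype.card_prod, Fintype.card_fin, sq]
  exact_mod_cast h

section Degree

variable {n : ℕ} {p k q : ℝ}

/-- The sum over all vertices of the squared difference of out-degree and in-degree. -/
noncomputable def degreeStat (n : ℕ) : (pairs n → SignType) → ℝ :=
  quadForm (fun a : Fin n => incidence a)

lemma sum_incidence_mul_bias (S : Finset (Fin n)) (π : Equiv.Perm {x : Fin n // x ∈ S})
    (a : Fin n) : ∑ e : pairs n, incidence a e * (2 * p * bias q S π e.1.1 e.1.2)
      = 2 * p * q * ∑ j, rankSign S π a j := by
  rw [← sum_incidence_mul a _ (rankSign_swap S π), Finset.mul_sum]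
  refine Finset.sum_congr rfl fun e _ => ?_
  rw [bias_eq_mul_rankSign q S π (pairs_ne e)]
  ring

lemma degreeStat_planted_mean (S : Finset (Fin n)) (π : Equiv.Perm {x : Fin n // x ∈ S}) :
    edgeExp p (fun e : pairs n => bias q S π e.1.1 e.1.2) (degreeStat n)
      = 2 * p * Fintype.card (pairs n)
        + 4 / 3 * p ^ 2 * q ^ 2 * (S.card * (S.card - 1) * (S.card - 2)) := by
  rw [degreeStat, edgeExp_quadForm, Finset.sum_add_distrib]
  simp only [sum_incidence_mul_bias, mul_pow _ (∑ j, rankSign S π _ j)]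
  rw [← Finset.mul_sum, sum_sum_rankSign_sq, Finset.sum_comm]
  have h1 : ∀ e : pairs n, ∑ a, incidence a e ^ 2 * (p - (2 * p * bias q S π e.1.1 e.1.2) ^ 2)
      = 2 * p - 8 * p ^ 2 * q ^ 2 * bias 1 S π e.1.1 e.1.2 ^ 2 := by
    intro e
    rw [← Finset.sum_mul, sum_incidence_sq, bias_eq_mul q]
    ring
  simp only [h1]
  rw [Finset.sum_sub_distrib, ← Finset.mul_sum _ _ (8 * p ^ 2 * q ^ 2), sum_bias_one_sq,
    Finset.sum_const, Finset.card_univ, nsmul_eq_mul]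
  ring

lemma degreeStat_null_mean :
    edgeExp p (fun _ : pairs n => 0) (degreeStat n) = 2 * p * Fintype.card (pairs n) := by
  rw [degreeStat, edgeExp_quadForm]
  simp only [mul_zero, Finset.sum_const_zero, ne_eq, OfNat.ofNat_ne_zero, not_false_eq_true,
    zero_pow, zero_add, sub_zero]
  rw [Finset.sum_comm]
  simp only [← Finset.sum_mul, sum_incidence_sq]
  rw [Finset.sum_const, Finset.card_univ, nsmul_eq_mul]
  ring

lemma degreeStat_planted_var_le (hp0 : 0 ≤ p) (hp1 : p ≤ 1) (hq0 : 0 ≤ q) (hq1 : q ≤ 1 / 2)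
    (hn : 1 ≤ n) (S : Finset (Fin n)) (π : Equiv.Perm {x : Fin n // x ∈ S}) :
    edgeExp p (fun e : pairs n => bias q S π e.1.1 e.1.2) (fun ω => (degreeStat n ω
        - edgeExp p (fun e : pairs n => bias q S π e.1.1 e.1.2) (degreeStat n)) ^ 2)
      ≤ 48 * p ^ 3 * q ^ 2 * n * (S.card : ℝ) ^ 3 + 48 * p ^ 2 * n ^ 3 + 8 * p * n ^ 2 := by
  have hn' : (1 : ℝ) ≤ n := by exact_mod_cast hn
  have hr : ∀ e : pairs n, |bias q S π e.1.1 e.1.2| ≤ 1 / 2 := fun e =>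
    (abs_bias_le hq0 S π _ _).trans hq1
  refine (edgeExp_quadForm_sub_sq_le hp0 hp1 hr (fun a : Fin n => incidence a) incidence_cube
    sum_incidence_sq (N := n) sum_incidence_sq_le).trans ?_
  simp only [sum_incidence_mul_bias]
  rw [Finset.sum_add_distrib, ← Finset.mul_sum]
  simp only [mul_pow _ (∑ j, rankSign S π _ j)]
  rw [← Finset.mul_sum, sum_sum_rankSign_sq, Finset.sum_const, Finset.card_univ,
    Fintype.card_fin, nsmul_eq_mul]
  have hc := mul_le_mul_of_nonneg_left (card_pairs_le n) (by positivity : 0 ≤ 8 * p)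
  set m : ℝ := (S.card : ℝ)
  have hm0 : 0 ≤ m := Nat.cast_nonneg _
  have h1 : m * (m ^ 2 - 1) / 3 ≤ m ^ 3 / 3 := by nlinarith
  have h2 : 16 * p * n * (2 * ((2 * p * q) ^ 2 * (m * (m ^ 2 - 1) / 3)))
      ≤ 16 * p * n * (2 * ((2 * p * q) ^ 2 * (m ^ 3 / 3))) := by gcongr
  have h3 : 16 * p * n * (n * ((n + 2) * p)) ≤ 16 * p * n * (n * ((n + 2 * n) * p)) := by
    gcongr
    linarith
  have h4 : 0 ≤ p ^ 3 * q ^ 2 * n * m ^ 3 := by positivity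
  rw [mul_add]
  nlinarith

lemma degreeStat_null_var_le (hp0 : 0 ≤ p) (hp1 : p ≤ 1) (hn : 1 ≤ n) :
    edgeExp p (fun _ : pairs n => 0) (fun ω => (degreeStat n ω
        - edgeExp p (fun _ : pairs n => 0) (degreeStat n)) ^ 2)
      ≤ 48 * p ^ 2 * n ^ 3 + 8 * p * n ^ 2 := by
  -- the null model is the planted model with an empty community
  have h := degreeStat_planted_var_le (q := 0) hp0 hp1 le_rfl (by norm_num) hn ∅ 1
  have hb : (fun e : pairs n => bias 0 (∅ : Finset (Fin n)) 1 e.1.1 e.1.2) = fun _ => 0 := by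
    funext e; simp [bias]
  rw [hb] at h
  simpa using h

/-- The degree statistic exceeds its null mean by at least a fixed fraction of the excess that is
expected from a community of size `k / 2`. -/
def DegreeEvent (n : ℕ) (p k q : ℝ) (ω : pairs n → SignType) : Prop :=
  2 * p * Fintype.card (pairs n) + p ^ 2 * q ^ 2 * k ^ 3 / 32 ≤ degreeStat n ω

/-- The error bound of the degree test, where `s` is a lower bound for `p q² m³` and `m` is the size
of the community. -/
noncomputable def degreeErr (n : ℕ) (p s : ℝ) : ℝ :=
  768 * n / s + 768 * n ^ 3 / s ^ 2 + 128 * n ^ 2 / (p * s ^ 2)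

lemma div_sq_eq_degreeErr (hp0 : 0 < p) {s : ℝ} (hs : 0 < s) :
    (48 * p ^ 2 * n * s + 48 * p ^ 2 * n ^ 3 + 8 * p * n ^ 2) / (p * s / 4) ^ 2
      = degreeErr n p s := by
  unfold degreeErr
  field_simp
  ring

lemma degreeErr_anti (hp0 : 0 < p) {s s' : ℝ} (hs : 0 < s) (hss : s ≤ s') :
    degreeErr n p s' ≤ degreeErr n p s := by
  unfold degreeErr
  gcongr

open Classical in
lemma degree_null_le (hp0 : 0 < p) (hp1 : p ≤ 1) (hk : 8 ≤ k) (hq0 : 0 < q) (hn : 1 ≤ n) :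
    edgeExp p (fun _ : pairs n => 0) (fun ω => if DegreeEvent n p k q ω then 1 else 0)
      ≤ degreeErr n p (p * q ^ 2 * k ^ 3 / 8) := by
  have hw0 : ∀ (_ : pairs n) y, 0 ≤ edgeMass p 0 y := fun _ y =>
    edgeMass_nonneg hp0.le hp1 (by norm_num) y
  set s := p * q ^ 2 * k ^ 3 / 8 with hs
  have hk0 : 0 < k := by linarith
  have hs0 : 0 < s := by positivity
  have hcheb := prodExp_indicator_le hw0 (degreeStat n) (2 * p * Fintype.card (pairs n))
    (t := p * s / 4) (by positivity) (DegreeEvent n p k q) (fun ω hω => by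
      refine le_trans ?_ (le_abs_self _)
      unfold DegreeEvent at hω
      have : p * s / 4 = p ^ 2 * q ^ 2 * k ^ 3 / 32 := by rw [hs]; ring
      linarith)
  refine hcheb.trans ?_
  have hv := degreeStat_null_var_le (n := n) hp0.le hp1 hn
  rw [degreeStat_null_mean] at hv
  rw [← div_sq_eq_degreeErr hp0 hs0]
  refine div_le_div_of_nonneg_right (hv.trans ?_) (by positivity)
  have : 0 ≤ 48 * p ^ 2 * n * s := by positivity
  linarith

open Classical in
lemma degree_planted_le (hp0 : 0 < p) (hp1 : p ≤ 1) (hk : 8 ≤ k) (hq0 : 0 < q) (hq1 : q ≤ 1 / 2)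
    (hn : 1 ≤ n) (S : Finset (Fin n)) (π : Equiv.Perm {x : Fin n // x ∈ S})
    (hS : k / 2 ≤ (S.card : ℝ)) :
    edgeExp p (fun e : pairs n => bias q S π e.1.1 e.1.2)
      (fun ω => if DegreeEvent n p k q ω then 0 else 1)
      ≤ degreeErr n p (p * q ^ 2 * k ^ 3 / 8) := by
  have hr : ∀ e : pairs n, |bias q S π e.1.1 e.1.2| ≤ 1 / 2 := fun e =>
    (abs_bias_le hq0.le S π _ _).trans hq1
  have hw0 : ∀ (e : pairs n) y, 0 ≤ edgeMass p (bias q S π e.1.1 e.1.2) y := fun e y =>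
    edgeMass_nonneg hp0.le hp1 (hr e) y
  have hmean := degreeStat_planted_mean (p := p) (q := q) S π
  have hvar := degreeStat_planted_var_le hp0.le hp1 hq0.le hq1 hn S π
  set m : ℝ := (S.card : ℝ) with hm
  have hm4 : 4 ≤ m := by linarith
  have hk0 : 0 < k := by linarith
  set s := p * q ^ 2 * m ^ 3 with hs
  have hs0 : 0 < s := by positivity
  have hks : p * q ^ 2 * k ^ 3 / 8 ≤ s := by
    have : (k / 2) ^ 3 ≤ m ^ 3 := pow_le_pow_left₀ (by positivity) hS 3
    have := mul_le_mul_of_nonneg_left this (by positivity : 0 ≤ p * q ^ 2)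
    rw [hs]; linarith
  have hexc : p * s / 2 ≤ 4 / 3 * p ^ 2 * q ^ 2 * (m * (m - 1) * (m - 2)) := by
    have h1 : 3 / 8 * m ^ 2 ≤ (m - 1) * (m - 2) := by nlinarith
    have h2 := mul_le_mul_of_nonneg_left h1
      (by positivity : 0 ≤ 4 / 3 * p ^ 2 * q ^ 2 * m)
    rw [hs]; linarith
  have hcheb := prodExp_indicator_le hw0 (degreeStat n)
    (edgeExp p (fun e : pairs n => bias q S π e.1.1 e.1.2) (degreeStat n)) (t := p * s / 4)
    (by positivity) (fun ω => ¬ DegreeEvent n p k q ω) (fun ω hω => by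
      unfold DegreeEvent at hω
      rw [not_le] at hω
      rw [hmean, abs_sub_comm]
      refine le_trans ?_ (le_abs_self _)
      have h3 := mul_le_mul_of_nonneg_left hks hp0.le
      linarith)
  simp only [ite_not] at hcheb
  refine hcheb.trans (le_trans ?_ (degreeErr_anti hp0 (by positivity) hks))
  rw [← div_sq_eq_degreeErr hp0 hs0]
  refine div_le_div_of_nonneg_right (hvar.trans (le_of_eq ?_)) (by positivity)
  rw [hs]; ring

end Degree

/-! ### Uniformly random rankings -/

/-- The average of `F` over all permutations of `A`. -/
noncomputable def permAvg {A : Type*} [Fintype A] [DecidableEq A] (F : Equiv.Perm A → ℝ) : ℝ :=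
  1 / ((Fintype.card A).factorial : ℝ) * ∑ σ, F σ

section PermAvg

variable {A B : Type*} [Fintype A] [DecidableEq A] [Fintype B] [DecidableEq B]

lemma permAvg_mono {F G : Equiv.Perm A → ℝ} (h : ∀ σ, F σ ≤ G σ) : permAvg F ≤ permAvg G :=
  mul_le_mul_of_nonneg_left (Finset.sum_le_sum fun σ _ => h σ) (by positivity)

lemma permAvg_const (c : ℝ) : permAvg (fun _ : Equiv.Perm A => c) = c := by
  unfold permAvg
  have h : ((Fintype.card A).factorial : ℝ) ≠ 0 := by exact_mod_cast Nat.factorial_ne_zero _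
  rw [Finset.sum_const, Finset.card_univ, Fintype.card_perm, nsmul_eq_mul]
  field_simp

end PermAvg

section Transfer

variable {A B : Type*} [Fintype A] [LinearOrder A] [Fintype B] [LinearOrder B]

omit [Fintype B] in
/-- The order in which a ranking of `B` lists the elements of `A` is given by a ranking of `A`. -/
lemma exists_perm_lt_iff (ι : A ↪ B) (σ : Equiv.Perm B) :
    ∃ τ : Equiv.Perm A, ∀ x y, τ x < τ y ↔ σ (ι x) < σ (ι y) := by
  classical
  let T : Finset B := Finset.univ.map (ι.trans σ.toEmbedding)
  let f : A ≃ T := Equiv.ofBijective (fun x => ⟨σ (ι x), by simp [T]⟩) <| by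
    constructor
    · intro x y h
      simpa using h
    · rintro ⟨y, hy⟩
      obtain ⟨x, -, hx⟩ := Finset.mem_map.1 hy
      exact ⟨x, Subtype.ext hx⟩
  let eT : Fin (Fintype.card A) ≃o T := T.orderIsoOfFin (by simp [T])
  let eA : Fin (Fintype.card A) ≃o A := Fintype.orderIsoFinOfCardEq A rfl
  refine ⟨f.trans (eT.symm.toEquiv.trans eA.toEquiv), fun x y => ?_⟩
  simp only [Equiv.trans_apply]
  change eA (eT.symm (f x)) < eA (eT.symm (f y)) ↔ _
  rw [eA.lt_iff_lt, eT.symm.lt_iff_lt]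
  exact Iff.rfl

/-- The order induced on `A` by a uniformly random ranking of `B` is uniformly random. Composing
the ranking of `B` with a permutation of `A` does not change its law, and averaging over these
permutations makes the induced ranking uniform. -/
lemma permAvg_transfer (ι : A ↪ B) (G : (A → A → ℝ) → ℝ) :
    permAvg (fun π : Equiv.Perm A => G fun x y => ordSign (π x) (π y))
      = permAvg fun σ : Equiv.Perm B => G fun x y => ordSign (σ (ι x)) (σ (ι y)) := by
  classical
  choose τ hτ using exists_perm_lt_iff (B := B) ι
  let F : Equiv.Perm B → ℝ := fun σ => G fun x y => ordSign (σ (ι x)) (σ (ι y))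
  let H : Equiv.Perm A → ℝ := fun π => G fun x y => ordSign (π x) (π y)
  have h1 : ∀ (g : Equiv.Perm A) (σ : Equiv.Perm B), F (σ * g.viaEmbedding ι) = H (τ σ * g) := by
    intro g σ
    simp only [F, H]
    congr 1
    funext x y
    simp only [Equiv.Perm.mul_apply, Equiv.Perm.viaEmbedding_apply]
    exact ordSign_congr (hτ σ _ _).symm (hτ σ _ _).symm
  have h2 : ∀ g : Equiv.Perm A, ∑ σ, F σ = ∑ σ, H (τ σ * g) := by
    intro g
    rw [← Equiv.sum_comp (Equiv.mulRight (g.viaEmbedding ι))]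
    exact Finset.sum_congr rfl fun σ _ => h1 g σ
  have h3 : (Fintype.card (Equiv.Perm A) : ℝ) * ∑ σ, F σ
      = (Fintype.card (Equiv.Perm B) : ℝ) * ∑ π, H π := by
    have : ∑ _g : Equiv.Perm A, ∑ σ, F σ = ∑ g : Equiv.Perm A, ∑ σ, H (τ σ * g) :=
      Finset.sum_congr rfl fun g _ => h2 g
    rw [Finset.sum_const, Finset.card_univ, nsmul_eq_mul, Finset.sum_comm] at this
    rw [this]
    have h4 : ∀ σ, ∑ g : Equiv.Perm A, H (τ σ * g) = ∑ π, H π := fun σ =>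
      Equiv.sum_comp (Equiv.mulLeft (τ σ)) H
    simp only [h4]
    rw [Finset.sum_const, Finset.card_univ, nsmul_eq_mul]
  rw [Fintype.card_perm, Fintype.card_perm] at h3
  have hA : ((Fintype.card A).factorial : ℝ) ≠ 0 := by exact_mod_cast Nat.factorial_ne_zero _
  have hB : ((Fintype.card B).factorial : ℝ) ≠ 0 := by exact_mod_cast Nat.factorial_ne_zero _
  change permAvg H = permAvg F
  unfold permAvg
  rw [one_div, one_div, inv_mul_eq_iff_eq_mul₀ hA, ← mul_assoc, mul_comm _ (_)⁻¹, mul_assoc,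
    eq_inv_mul_iff_mul_eq₀ hB]
  exact h3.symm

end Transfer

/-! ### The moment generating function of Kendall's statistic -/

/-- The permutation of `Fin (m + 1)` that sends `0` to `p` and lists the other values in the order
given by `e`. -/
def consPermFun {m : ℕ} (z : Fin (m + 1) × Equiv.Perm (Fin m)) : Fin (m + 1) → Fin (m + 1) :=
  Fin.cons z.1 fun i => z.1.succAbove (z.2 i)

lemma consPermFun_injective {m : ℕ} (z : Fin (m + 1) × Equiv.Perm (Fin m)) :
    Function.Injective (consPermFun z) := by
  unfold consPermFun
  rw [Fin.cons_injective_iff]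
  refine ⟨?_, (Fin.succAbove_right_injective).comp z.2.injective⟩
  rintro ⟨i, hi⟩
  exact Fin.succAbove_ne _ _ hi

/-- The permutation with underlying function `consPermFun`. -/
noncomputable def consPerm {m : ℕ} (z : Fin (m + 1) × Equiv.Perm (Fin m)) :
    Equiv.Perm (Fin (m + 1)) :=
  Equiv.ofBijective (consPermFun z) (Finite.injective_iff_bijective.1 (consPermFun_injective z))

lemma consPerm_zero {m : ℕ} (z : Fin (m + 1) × Equiv.Perm (Fin m)) : consPerm z 0 = z.1 := rfl

lemma consPerm_succ {m : ℕ} (z : Fin (m + 1) × Equiv.Perm (Fin m)) (i : Fin m) :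
    consPerm z i.succ = z.1.succAbove (z.2 i) := rfl

lemma consPerm_bijective (m : ℕ) : Function.Bijective (consPerm (m := m)) := by
  rw [Fintype.bijective_iff_injective_and_card]
  constructor
  · rintro ⟨p, e⟩ ⟨p', e'⟩ h
    have hp : p = p' := by
      have := congrArg (fun σ : Equiv.Perm _ => σ 0) h
      simpa [consPerm_zero] using this
    subst hp
    congr 1
    ext i
    have := congrArg (fun σ : Equiv.Perm _ => σ i.succ) h
    simp only [consPerm_succ] at this
    rw [Fin.succAbove_right_injective this]
  · simp [Fintype.card_perm, Nat.factorial_succ]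

/-- Twice Kendall's statistic: the number of ordered pairs that `τ` keeps in order, minus the
number of ordered pairs that it reverses. -/
noncomputable def kendall {m : ℕ} (τ : Equiv.Perm (Fin m)) : ℝ :=
  ∑ a, ∑ b, ordSign a b * ordSign (τ a) (τ b)

lemma kendall_consPerm {m : ℕ} (p : Fin (m + 1)) (e : Equiv.Perm (Fin m)) :
    kendall (consPerm (p, e)) = 2 * ∑ c, ordSign p c + kendall e := by
  have h0 : ∀ b : Fin m, ordSign (0 : Fin (m + 1)) b.succ = 1 := fun b =>
    ordSign_of_lt (Fin.succ_pos b)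
  have h1 : ∀ b : Fin m, ordSign b.succ (0 : Fin (m + 1)) = -1 := fun b => by
    rw [ordSign_swap, h0]
  have hs : ∀ a b : Fin m, ordSign a.succ b.succ = ordSign a b := fun a b =>
    ordSign_congr Fin.succ_lt_succ_iff Fin.succ_lt_succ_iff
  have hp : ∀ a b : Fin m, ordSign (p.succAbove a) (p.succAbove b) = ordSign a b := fun a b =>
    ordSign_congr (Fin.strictMono_succAbove p).lt_iff_lt (Fin.strictMono_succAbove p).lt_iff_lt
  have hX : ∑ b, ordSign p (p.succAbove (e b)) = ∑ c, ordSign p c := by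
    rw [Fin.sum_univ_succAbove _ p, ordSign_self, zero_add,
      Equiv.sum_comp e (fun b => ordSign p (p.succAbove b))]
  have hX' : ∑ b, -1 * ordSign (p.succAbove (e b)) p = ∑ c, ordSign p c := by
    rw [← hX]
    exact Finset.sum_congr rfl fun b _ => by rw [ordSign_swap p]; ring
  unfold kendall
  rw [Fin.sum_univ_succ]
  simp only [Fin.sum_univ_succ (n := m), ordSign_self, zero_mul, zero_add, h0, h1, hs,
    consPerm_zero, consPerm_succ, hp, one_mul, Finset.sum_add_distrib]
  have hX2 : ∑ x, -1 * ordSign (p.succAbove (e x)) p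
      = ordSign p 0 + ∑ i : Fin m, ordSign p i.succ := by
    rw [hX', Fin.sum_univ_succ]
  have hX3 : ∑ b, ordSign p (p.succAbove (e b)) = ordSign p 0 + ∑ i : Fin m, ordSign p i.succ := by
    rw [hX, Fin.sum_univ_succ]
  rw [hX2, hX3]
  ring

lemma sum_exp_ordSign_le (m : ℕ) (θ : ℝ) :
    ∑ p : Fin (m + 1), Real.exp (2 * θ * ∑ c, ordSign p c)
      ≤ (m + 1) * Real.exp (2 * θ ^ 2 * m ^ 2) := by
  have hX : ∀ p : Fin (m + 1), ∑ c, ordSign p c = (m : ℝ) - 2 * (p : ℕ) := by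
    intro p
    rw [sum_ordSign_fin]; push_cast; ring
  simp only [hX]
  -- the exponent is symmetric about `0`, so the sum is one of hyperbolic cosines
  have hrev : ∑ p : Fin (m + 1), Real.exp (2 * θ * ((m : ℝ) - 2 * (p : ℕ)))
      = ∑ p : Fin (m + 1), Real.exp (-(2 * θ * ((m : ℝ) - 2 * (p : ℕ)))) := by
    rw [← Equiv.sum_comp Fin.revPerm]
    refine Finset.sum_congr rfl fun p _ => ?_
    congr 1
    have hp : (p : ℕ) ≤ m := Nat.lt_succ_iff.1 p.2
    rw [Fin.revPerm_apply, Fin.val_rev, show m + 1 - ((p : ℕ) + 1) = m - p by omega,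
      Nat.cast_sub hp]
    ring
  have hcosh : ∑ p : Fin (m + 1), Real.exp (2 * θ * ((m : ℝ) - 2 * (p : ℕ)))
      = ∑ p : Fin (m + 1), Real.cosh (2 * θ * ((m : ℝ) - 2 * (p : ℕ))) := by
    have : ∀ p : Fin (m + 1), Real.cosh (2 * θ * ((m : ℝ) - 2 * (p : ℕ)))
      = 1 / 2 * Real.exp (2 * θ * ((m : ℝ) - 2 * (p : ℕ)))
        + 1 / 2 * Real.exp (-(2 * θ * ((m : ℝ) - 2 * (p : ℕ)))) := fun p => by
      rw [Real.cosh_eq]; ring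
    simp only [this]
    rw [Finset.sum_add_distrib, ← Finset.mul_sum, ← Finset.mul_sum, ← hrev]
    ring
  rw [hcosh]
  have hle : ∀ p ∈ (Finset.univ : Finset (Fin (m + 1))),
      Real.cosh (2 * θ * ((m : ℝ) - 2 * (p : ℕ))) ≤ Real.exp (2 * θ ^ 2 * m ^ 2) := by
    intro p _
    refine (Real.cosh_le_exp_half_sq _).trans (Real.exp_le_exp.2 ?_)
    have hp : ((p : ℕ) : ℝ) ≤ m := by exact_mod_cast Nat.lt_succ_iff.1 p.2
    have hp0 : (0 : ℝ) ≤ (p : ℕ) := Nat.cast_nonneg _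
    have h1 : ((m : ℝ) - 2 * (p : ℕ)) ^ 2 ≤ m ^ 2 := by nlinarith
    have := mul_le_mul_of_nonneg_left h1 (by positivity : 0 ≤ 2 * θ ^ 2)
    nlinarith
  refine (Finset.sum_le_sum hle).trans ?_
  rw [Finset.sum_const, Finset.card_univ, Fintype.card_fin, nsmul_eq_mul]
  push_cast
  exact le_rfl

/-- Kendall's statistic is a sum of independent symmetric variables bounded by `0, …, m - 1`, so
it is sub-Gaussian with variance proxy of order `m³`. -/
lemma permAvg_exp_kendall_le (m : ℕ) (θ : ℝ) :
    permAvg (fun τ : Equiv.Perm (Fin m) => Real.exp (θ * kendall τ))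
      ≤ Real.exp (2 * θ ^ 2 * m ^ 3) := by
  induction m with
  | zero => simp [permAvg, kendall]
  | succ m ih =>
    unfold permAvg at ih ⊢
    rw [Fintype.card_fin] at ih ⊢
    rw [← Function.Bijective.sum_comp (consPerm_bijective m), Fintype.sum_prod_type]
    have h1 : ∀ (p : Fin (m + 1)) (e : Equiv.Perm (Fin m)),
        Real.exp (θ * kendall (consPerm (p, e)))
          = Real.exp (2 * θ * ∑ c, ordSign p c) * Real.exp (θ * kendall e) := by
      intro p e
      rw [kendall_consPerm, ← Real.exp_add]
      congr 1; ring
    simp only [h1]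
    rw [← Finset.sum_mul_sum, Nat.factorial_succ]
    have hf : (0 : ℝ) < (m.factorial : ℝ) := by exact_mod_cast Nat.factorial_pos _
    push_cast
    calc 1 / (((m : ℝ) + 1) * m.factorial) *
          ((∑ p : Fin (m + 1), Real.exp (2 * θ * ∑ c, ordSign p c))
          * ∑ e : Equiv.Perm (Fin m), Real.exp (θ * kendall e))
        = (1 / ((m : ℝ) + 1) * ∑ p : Fin (m + 1), Real.exp (2 * θ * ∑ c, ordSign p c))
          * (1 / (m.factorial : ℝ) * ∑ e : Equiv.Perm (Fin m), Real.exp (θ * kendall e)) := by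
          field_simp
      _ ≤ Real.exp (2 * θ ^ 2 * m ^ 2) * Real.exp (2 * θ ^ 2 * m ^ 3) := by
          refine mul_le_mul ?_ ih (by positivity) (Real.exp_pos _).le
          rw [one_div, inv_mul_le_iff₀ (by positivity)]
          exact sum_exp_ordSign_le m θ
      _ ≤ Real.exp (2 * θ ^ 2 * ((m : ℝ) + 1) ^ 3) := by
          rw [← Real.exp_add]
          refine Real.exp_le_exp.2 ?_
          have hm : (0 : ℝ) ≤ m := Nat.cast_nonneg _
          have : (m : ℝ) ^ 2 + m ^ 3 ≤ (m + 1) ^ 3 := by nlinarith [sq_nonneg (m : ℝ)]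
          have := mul_le_mul_of_nonneg_left this (by positivity : 0 ≤ 2 * θ ^ 2)
          linarith

/-! ### Two independent random rankings -/

/-- The comparison signs in `S` of a ranking `σ` of all vertices. -/
def restrictSign {n : ℕ} (S : Finset (Fin n)) (σ : Equiv.Perm (Fin n)) (i j : Fin n) : ℝ :=
  if i ∈ S ∧ j ∈ S then ordSign (σ i) (σ j) else 0

lemma permAvg_rankSign {n : ℕ} (S : Finset (Fin n)) (G : (Fin n → Fin n → ℝ) → ℝ) :
    permAvg (fun π : Equiv.Perm {x : Fin n // x ∈ S} => G (rankSign S π))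
      = permAvg fun σ : Equiv.Perm (Fin n) => G (restrictSign S σ) := by
  have h := permAvg_transfer (Function.Embedding.subtype fun x : Fin n => x ∈ S)
    (fun M => G fun i j => if h : i ∈ S ∧ j ∈ S then M ⟨i, h.1⟩ ⟨j, h.2⟩ else 0)
  have hr : ∀ σ : Equiv.Perm (Fin n), restrictSign S σ
      = fun i j => if _h : i ∈ S ∧ j ∈ S then ordSign (σ i) (σ j) else 0 := by
    intro σ; funext i j; simp [restrictSign]
  simp only [hr]
  exact h

/-- The exponential moment of the agreement of two rankings on the intersection of their
supports; by symmetry, one of the two rankings may be held fixed. -/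
lemma permAvg_exp_restrictSign_le {n : ℕ} (S S' : Finset (Fin n)) (σ' : Equiv.Perm (Fin n))
    (θ : ℝ) :
    permAvg (fun σ : Equiv.Perm (Fin n) =>
        Real.exp (θ * ∑ i, ∑ j, restrictSign S σ i j * restrictSign S' σ' i j))
      ≤ Real.exp (2 * θ ^ 2 * ((S ∩ S').card : ℝ) ^ 3) := by
  set U := S ∩ S' with hU
  let V : Finset (Fin n) := U.map σ'.toEmbedding
  have hV : V.card = U.card := Finset.card_map _
  -- `ι` lists the elements of `U` in the order given by `σ'`
  let ι : Fin U.card ↪ Fin n := (V.orderEmbOfFin hV).toEmbedding.trans σ'.symm.toEmbedding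
  have hι : ∀ a b, ordSign (σ' (ι a)) (σ' (ι b)) = ordSign a b := by
    intro a b
    have : ∀ a, σ' (ι a) = V.orderEmbOfFin hV a := fun a => by simp [ι]
    rw [this, this]
    exact ordSign_congr (V.orderEmbOfFin hV).lt_iff_lt (V.orderEmbOfFin hV).lt_iff_lt
  have hsum : ∀ g : Fin n → ℝ, (∀ i ∉ U, g i = 0) → ∑ i, g i = ∑ a, g (ι a) := by
    intro g hg
    have h1 : Finset.univ.map ι = U := by
      ext i
      simp only [ι, Finset.mem_map, Finset.mem_univ, true_and, Function.Embedding.trans_apply]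
      constructor
      · rintro ⟨a, rfl⟩
        have := V.orderEmbOfFin_mem hV a
        obtain ⟨u, hu, huv⟩ := Finset.mem_map.1 this
        change σ'.symm (V.orderEmbOfFin hV a) ∈ U
        rw [← huv]
        simpa using hu
      · intro hi
        have : σ' i ∈ Set.range (V.orderEmbOfFin hV) := by
          rw [Finset.range_orderEmbOfFin]
          exact Finset.mem_map_of_mem σ'.toEmbedding hi
        obtain ⟨a, ha⟩ := this
        refine ⟨a, ?_⟩
        change σ'.symm (V.orderEmbOfFin hV a) = i
        rw [ha]; simp
    rw [← Finset.sum_subset (Finset.subset_univ U) (fun i _ hi => hg i hi)]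
    conv_lhs => rw [← h1]
    rw [Finset.sum_map]
  have hmem : ∀ a, ι a ∈ S ∧ ι a ∈ S' := by
    intro a
    have := V.orderEmbOfFin_mem hV a
    obtain ⟨u, hu, huv⟩ := Finset.mem_map.1 this
    have h2 : ι a = u := by
      change σ'.symm (V.orderEmbOfFin hV a) = u
      rw [← huv]; simp
    rw [h2]
    exact Finset.mem_inter.1 hu
  have hred : ∀ σ : Equiv.Perm (Fin n),
      ∑ i, ∑ j, restrictSign S σ i j * restrictSign S' σ' i j
        = ∑ a, ∑ b, ordSign a b * ordSign (σ (ι a)) (σ (ι b)) := by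
    intro σ
    have hz : ∀ i j, (i ∉ U ∨ j ∉ U) → restrictSign S σ i j * restrictSign S' σ' i j = 0 := by
      intro i j hij
      simp only [hU, Finset.mem_inter] at hij
      unfold restrictSign
      split_ifs <;> first | (exfalso; tauto) | simp
    rw [hsum _ (fun i hi => Finset.sum_eq_zero fun j _ => hz i j (Or.inl hi))]
    refine Finset.sum_congr rfl fun a _ => ?_
    rw [hsum _ (fun j hj => hz _ j (Or.inr hj))]
    refine Finset.sum_congr rfl fun b _ => ?_
    rw [restrictSign, restrictSign, if_pos ⟨(hmem a).1, (hmem b).1⟩,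
      if_pos ⟨(hmem a).2, (hmem b).2⟩, hι]
    ring
  simp only [hred]
  have h := permAvg_transfer ι
    (fun M => Real.exp (θ * ∑ a, ∑ b, ordSign a b * M a b))
  rw [← h]
  exact permAvg_exp_kendall_le U.card θ

/-- The average over two independent rankings of the expected product of the two likelihood
ratios. -/
lemma permAvg_permAvg_prod_le {n : ℕ} {p q : ℝ} (hp0 : 0 ≤ p) (hp1 : p ≤ 1) (hq0 : 0 ≤ q)
    (hq1 : q ≤ 1 / 2) (S S' : Finset (Fin n)) :
    permAvg (fun π : Equiv.Perm {x : Fin n // x ∈ S} =>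
      permAvg fun π' : Equiv.Perm {x : Fin n // x ∈ S'} =>
        ∏ e : pairs n, (1 + 4 * p * bias q S π e.1.1 e.1.2 * bias q S' π' e.1.1 e.1.2))
      ≤ Real.exp (8 * (p * q ^ 2) ^ 2 * ((S ∩ S').card : ℝ) ^ 3) := by
  have hexp : ∀ (π : Equiv.Perm {x : Fin n // x ∈ S}) (π' : Equiv.Perm {x : Fin n // x ∈ S'}),
      ∏ e : pairs n, (1 + 4 * p * bias q S π e.1.1 e.1.2 * bias q S' π' e.1.1 e.1.2)
        ≤ Real.exp (2 * p * q ^ 2 * ∑ i, ∑ j, rankSign S π i j * rankSign S' π' i j) := by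
    intro π π'
    have h := sum_sum_eq_diag_add_two_mul (fun i j => rankSign S π i j * rankSign S' π' i j)
      (fun i j => by rw [rankSign_swap S π j i, rankSign_swap S' π' j i]; ring)
    have hd : ∀ i, rankSign S π i i = 0 := fun i => by
      have := rankSign_swap S π i i; linarith
    simp only [hd, zero_mul, Finset.sum_const_zero, zero_add] at h
    rw [h, ← mul_assoc, Finset.mul_sum, Real.exp_sum]
    refine Finset.prod_le_prod (fun e _ => ?_) fun e _ => ?_
    · have h1 := abs_bias_le hq0 S π e.1.1 e.1.2
      have h2 := abs_bias_le hq0 S' π' e.1.1 e.1.2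
      have h3 : |bias q S π e.1.1 e.1.2 * bias q S' π' e.1.1 e.1.2| ≤ 1 / 2 * (1 / 2) := by
        rw [abs_mul]
        exact mul_le_mul (h1.trans hq1) (h2.trans hq1) (abs_nonneg _) (by norm_num)
      have h4 := (abs_le.1 h3).1
      nlinarith
    · rw [bias_eq_mul_rankSign q S π (pairs_ne e), bias_eq_mul_rankSign q S' π' (pairs_ne e)]
      have := Real.add_one_le_exp (2 * p * q ^ 2 * 2
        * (rankSign S π e.1.1 e.1.2 * rankSign S' π' e.1.1 e.1.2))
      linarith
  refine (permAvg_mono fun π => permAvg_mono fun π' => hexp π π').trans ?_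
  rw [permAvg_rankSign S (fun M => permAvg fun π' : Equiv.Perm {x : Fin n // x ∈ S'} =>
    Real.exp (2 * p * q ^ 2 * ∑ i, ∑ j, M i j * rankSign S' π' i j))]
  have h1 : ∀ σ : Equiv.Perm (Fin n), permAvg (fun π' : Equiv.Perm {x : Fin n // x ∈ S'} =>
      Real.exp (2 * p * q ^ 2 * ∑ i, ∑ j, restrictSign S σ i j * rankSign S' π' i j))
      ≤ Real.exp (8 * (p * q ^ 2) ^ 2 * ((S ∩ S').card : ℝ) ^ 3) := by
    intro σ
    rw [permAvg_rankSign S' (fun M =>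
      Real.exp (2 * p * q ^ 2 * ∑ i, ∑ j, restrictSign S σ i j * M i j))]
    have := permAvg_exp_restrictSign_le S' S σ (2 * p * q ^ 2)
    simp only [mul_comm (restrictSign S' _ _ _)] at this
    refine this.trans (le_of_eq ?_)
    rw [Finset.inter_comm]
    congr 1; ring
  exact (permAvg_mono h1).trans (permAvg_const _).le

/-! ### The second moment of the likelihood ratio -/

/-- The exponential moment of the size of the intersection of two independent communities. -/
lemma sum_sum_communityMass_mul_pow (n : ℕ) (k c : ℝ) :
    ∑ S : Finset (Fin n), ∑ S' : Finset (Fin n),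
      communityMass n k S * communityMass n k S' * c ^ (S ∩ S').card
      = (1 + (k / n) ^ 2 * (c - 1)) ^ n := by
  have h1 : ∀ S : Finset (Fin n), ∑ S' : Finset (Fin n),
      communityMass n k S * communityMass n k S' * c ^ (S ∩ S').card
      = communityMass n k S * (1 + k / n * (c - 1)) ^ S.card := by
    intro S
    have h := Finset.prod_add (fun i : Fin n => k / n * if i ∈ S then c else 1)
      (fun _ => 1 - k / n) Finset.univ
    have hl : ∏ i : Fin n, (k / n * (if i ∈ S then c else 1) + (1 - k / n))
        = (1 + k / n * (c - 1)) ^ S.card := by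
      have : ∀ i : Fin n, k / n * (if i ∈ S then c else 1) + (1 - k / n)
          = if i ∈ S then 1 + k / n * (c - 1) else 1 := by
        intro i; split_ifs <;> ring
      simp only [this]
      rw [Finset.prod_ite_mem, Finset.univ_inter, Finset.prod_const]
    rw [← hl, h, Finset.powerset_univ, Finset.mul_sum]
    refine Finset.sum_congr rfl fun S' _ => ?_
    rw [Finset.prod_mul_distrib, Finset.prod_const, Finset.prod_const, Finset.prod_ite_mem,
      Finset.prod_const, ← Finset.compl_eq_univ_sdiff, Finset.card_compl, Fintype.card_fin,
      Finset.inter_comm S' S, communityMass]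
    unfold communityMass
    ring
  simp only [h1]
  rw [sum_communityMass_mul_pow]
  congr 1; ring

section SecondMoment

variable {n : ℕ} {p k q : ℝ}

/-- The likelihood ratio of the edges given the ranked community `(S, π)`. -/
noncomputable def condRatio (q : ℝ) (S : Finset (Fin n)) (π : Equiv.Perm {x : Fin n // x ∈ S})
    (ω : pairs n → SignType) : ℝ :=
  ∏ e : pairs n, (1 + 2 * bias q S π e.1.1 e.1.2 * (ω e : ℝ))

lemma condMass_eq_mul (S : Finset (Fin n)) (π : Equiv.Perm {x : Fin n // x ∈ S})
    (Y : OrientedGraph n) :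
    condMass p q S π Y = nullMass n p Y * condRatio q S π (edgeVec Y) := by
  have h : ∀ (r : ℝ) (y : SignType), edgeMass p r y = edgeMass p 0 y * (1 + 2 * r * (y : ℝ)) := by
    intro r y
    rcases y with _ | _ | _
    · change edgeMass p r 0 = edgeMass p 0 0 * (1 + 2 * r * ((0 : SignType) : ℝ))
      rw [edgeMass_zero, edgeMass_zero]; simp
    · change edgeMass p r (-1) = edgeMass p 0 (-1) * (1 + 2 * r * ((-1 : SignType) : ℝ))
      rw [edgeMass_neg_one, edgeMass_neg_one]; simp; ring
    · change edgeMass p r 1 = edgeMass p 0 1 * (1 + 2 * r * ((1 : SignType) : ℝ))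
      rw [edgeMass_one, edgeMass_one]; simp; ring
  unfold condMass nullMass condRatio
  have h2 : ∏ e : pairs n, (1 + 2 * bias q S π e.1.1 e.1.2 * (edgeVec Y e : ℝ))
      = ∏ e ∈ pairs n, (1 + 2 * bias q S π e.1 e.2 * (Y.1 e.1 e.2 : ℝ)) :=
    Finset.prod_coe_sort (pairs n) (fun e => 1 + 2 * bias q S π e.1 e.2 * (Y.1 e.1 e.2 : ℝ))
  rw [h2, ← Finset.prod_mul_distrib]
  exact Finset.prod_congr rfl fun e _ => h _ _

lemma edgeExp_condRatio (S : Finset (Fin n)) (π : Equiv.Perm {x : Fin n // x ∈ S}) :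
    edgeExp p (fun _ : pairs n => 0) (condRatio q S π) = 1 := by
  unfold edgeExp condRatio
  rw [prodExp_prod (fun (e : pairs n) (y : SignType) => 1 + 2 * bias q S π e.1.1 e.1.2 * (y : ℝ))]
  refine Finset.prod_eq_one fun e _ => ?_
  rw [sum_signType, edgeMass_zero, edgeMass_one, edgeMass_neg_one]; simp; ring

lemma edgeExp_condRatio_mul (S S' : Finset (Fin n)) (π : Equiv.Perm {x : Fin n // x ∈ S})
    (π' : Equiv.Perm {x : Fin n // x ∈ S'}) :
    edgeExp p (fun _ : pairs n => 0) (fun ω => condRatio q S π ω * condRatio q S' π' ω)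
      = ∏ e : pairs n, (1 + 4 * p * bias q S π e.1.1 e.1.2 * bias q S' π' e.1.1 e.1.2) := by
  unfold edgeExp condRatio
  simp only [← Finset.prod_mul_distrib]
  rw [prodExp_prod (fun (e : pairs n) (y : SignType) =>
    (1 + 2 * bias q S π e.1.1 e.1.2 * (y : ℝ)) * (1 + 2 * bias q S' π' e.1.1 e.1.2 * (y : ℝ)))]
  refine Finset.prod_congr rfl fun e _ => ?_
  rw [sum_signType, edgeMass_zero, edgeMass_one, edgeMass_neg_one]; simp; ring

/-- The mass of `S`, restricted to communities of at most twice the expected size. -/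
noncomputable def truncMass (n : ℕ) (k : ℝ) (S : Finset (Fin n)) : ℝ :=
  if 2 * k < (S.card : ℝ) then 0 else communityMass n k S

/-- The likelihood ratio of the planted model, restricted to communities of at most twice the
expected size, with respect to the null model. Without the restriction, its second moment would be
dominated by exceptionally large communities. -/
noncomputable def truncRatio (n : ℕ) (k q : ℝ) (ω : pairs n → SignType) : ℝ :=
  ∑ S : Finset (Fin n), truncMass n k S *
    permAvg fun π : Equiv.Perm {x : Fin n // x ∈ S} => condRatio q S π ω

lemma truncMass_nonneg (hk0 : 0 ≤ k) (hkn : k ≤ n) (S : Finset (Fin n)) :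
    0 ≤ truncMass n k S := by
  unfold truncMass
  split_ifs
  · exact le_rfl
  · exact communityMass_nonneg hk0 hkn S

lemma truncMass_le (hk0 : 0 ≤ k) (hkn : k ≤ n) (S : Finset (Fin n)) :
    truncMass n k S ≤ communityMass n k S := by
  unfold truncMass
  split_ifs
  · exact communityMass_nonneg hk0 hkn S
  · exact le_rfl

lemma edgeExp_permAvg {A : Type*} [Fintype A] [DecidableEq A] {ι : Type*} [Fintype ι]
    [DecidableEq ι] {r : ι → ℝ} (F : Equiv.Perm A → (ι → SignType) → ℝ) :
    edgeExp p r (fun ω => permAvg fun π => F π ω) = permAvg fun π => edgeExp p r (F π) := by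
  unfold edgeExp permAvg
  rw [prodExp_const_mul, prodExp_sum]

lemma edgeExp_truncRatio_ge (hk0 : 0 ≤ k) (hkn : k ≤ n) :
    1 - Real.exp (-(k / 10)) ≤ edgeExp p (fun _ : pairs n => 0) (truncRatio n k q) := by
  have h1 : edgeExp p (fun _ : pairs n => 0) (truncRatio n k q)
      = ∑ S : Finset (Fin n), truncMass n k S := by
    unfold truncRatio
    have : ∀ S : Finset (Fin n), edgeExp p (fun _ : pairs n => 0) (fun ω => truncMass n k S *
        permAvg fun π : Equiv.Perm {x : Fin n // x ∈ S} => condRatio q S π ω)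
          = truncMass n k S := by
      intro S
      have h2 := edgeExp_permAvg (p := p) (r := fun _ : pairs n => 0)
        (fun π : Equiv.Perm {x : Fin n // x ∈ S} => condRatio q S π)
      simp only [edgeExp_condRatio, permAvg_const] at h2
      unfold edgeExp at h2 ⊢
      rw [prodExp_const_mul, h2, mul_one]
    unfold edgeExp at this ⊢
    rw [prodExp_sum]
    exact Finset.sum_congr rfl fun S _ => this S
  have h2 : ∑ S : Finset (Fin n), truncMass n k S = 1
      - ∑ S : Finset (Fin n), (if 2 * k < (S.card : ℝ) then communityMass n k S else 0) := by
    rw [← sum_communityMass n k, ← Finset.sum_sub_distrib]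
    refine Finset.sum_congr rfl fun S _ => ?_
    unfold truncMass
    split_ifs <;> ring
  rw [h1, h2]
  linarith [sum_communityMass_large_le hk0 hkn]

lemma edgeExp_truncRatio_sq_le_sum (hp0 : 0 ≤ p) (hp1 : p ≤ 1) (hk0 : 0 ≤ k) (hkn : k ≤ n)
    (hq0 : 0 ≤ q) (hq1 : q ≤ 1 / 2) :
    edgeExp p (fun _ : pairs n => 0) (fun ω => truncRatio n k q ω ^ 2)
      ≤ ∑ S : Finset (Fin n), ∑ S' : Finset (Fin n), truncMass n k S * truncMass n k S'
        * Real.exp (8 * (p * q ^ 2) ^ 2 * ((S ∩ S').card : ℝ) ^ 3) := by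
  have h1 : ∀ ω, truncRatio n k q ω ^ 2 = ∑ S : Finset (Fin n), ∑ S' : Finset (Fin n),
      truncMass n k S * truncMass n k S' *
        permAvg fun π : Equiv.Perm {x : Fin n // x ∈ S} =>
          permAvg fun π' : Equiv.Perm {x : Fin n // x ∈ S'} =>
            condRatio q S π ω * condRatio q S' π' ω := by
    intro ω
    rw [sq, truncRatio, Finset.sum_mul_sum]
    refine Finset.sum_congr rfl fun S _ => Finset.sum_congr rfl fun S' _ => ?_
    have : (permAvg fun π : Equiv.Perm {x : Fin n // x ∈ S} =>
          permAvg fun π' : Equiv.Perm {x : Fin n // x ∈ S'} =>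
            condRatio q S π ω * condRatio q S' π' ω)
        = (permAvg fun π : Equiv.Perm {x : Fin n // x ∈ S} => condRatio q S π ω)
          * permAvg fun π' : Equiv.Perm {x : Fin n // x ∈ S'} => condRatio q S' π' ω := by
      unfold permAvg
      simp only [← Finset.mul_sum, ← Finset.sum_mul]
      ring
    rw [this]
    ring
  simp only [h1]
  unfold edgeExp
  simp only [prodExp_sum, prodExp_const_mul]
  refine Finset.sum_le_sum fun S _ => Finset.sum_le_sum fun S' _ => ?_
  refine mul_le_mul_of_nonneg_left ?_
    (mul_nonneg (truncMass_nonneg hk0 hkn S) (truncMass_nonneg hk0 hkn S'))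
  refine le_trans (le_of_eq ?_) (permAvg_permAvg_prod_le hp0 hp1 hq0 hq1 S S')
  have h2 := edgeExp_permAvg (p := p) (r := fun _ : pairs n => 0)
    (fun (π : Equiv.Perm {x : Fin n // x ∈ S}) ω =>
      permAvg fun π' : Equiv.Perm {x : Fin n // x ∈ S'} =>
        condRatio q S π ω * condRatio q S' π' ω)
  refine h2.trans ?_
  congr 1
  funext π
  rw [edgeExp_permAvg]
  congr 1
  funext π'
  exact edgeExp_condRatio_mul S S' π π'

/-- Intersections of size at most `T` contribute at most the first term. On larger ones, the
truncation makes the exponent at most linear in the size, and the second term bounds their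
contribution by Markov's inequality for `exp (2 * |S ∩ S'|)`. -/
lemma edgeExp_truncRatio_sq_le (hp0 : 0 ≤ p) (hp1 : p ≤ 1) (hk0 : 0 ≤ k) (hkn : k ≤ n)
    (hq0 : 0 ≤ q) (hq1 : q ≤ 1 / 2) (hkpq : 32 * (p * q ^ 2 * k) ^ 2 ≤ 1) (T : ℝ) :
    edgeExp p (fun _ : pairs n => 0) (fun ω => truncRatio n k q ω ^ 2)
      ≤ Real.exp (8 * (p * q ^ 2) ^ 2 * T ^ 3) + Real.exp (7 * (k ^ 2 / n) - T) := by
  refine (edgeExp_truncRatio_sq_le_sum hp0 hp1 hk0 hkn hq0 hq1).trans ?_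
  have hterm : ∀ S S' : Finset (Fin n), truncMass n k S * truncMass n k S'
        * Real.exp (8 * (p * q ^ 2) ^ 2 * ((S ∩ S').card : ℝ) ^ 3)
      ≤ Real.exp (8 * (p * q ^ 2) ^ 2 * T ^ 3) * (communityMass n k S * communityMass n k S')
        + Real.exp (-T) * (communityMass n k S * communityMass n k S'
          * Real.exp 2 ^ (S ∩ S').card) := by
    intro S S'
    have hS := communityMass_nonneg hk0 hkn S
    have hS' := communityMass_nonneg hk0 hkn S'
    have hSS := mul_nonneg hS hS'
    by_cases hlarge : 2 * k < (S.card : ℝ)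
    · rw [truncMass, if_pos hlarge, zero_mul, zero_mul]
      positivity
    · have htr : truncMass n k S * truncMass n k S' ≤ communityMass n k S * communityMass n k S' :=
        mul_le_mul (truncMass_le hk0 hkn S) (truncMass_le hk0 hkn S')
          (truncMass_nonneg hk0 hkn S') hS
      refine (mul_le_mul_of_nonneg_right htr (Real.exp_pos _).le).trans ?_
      have hm0 : (0 : ℝ) ≤ ((S ∩ S').card : ℝ) := Nat.cast_nonneg _
      have hm2k : ((S ∩ S').card : ℝ) ≤ 2 * k := by
        refine le_trans ?_ (not_lt.1 hlarge)
        exact_mod_cast Finset.card_le_card Finset.inter_subset_left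
      rw [← Real.exp_nat_mul]
      set m : ℝ := ((S ∩ S').card : ℝ)
      have hexp : Real.exp (8 * (p * q ^ 2) ^ 2 * m ^ 3)
          ≤ Real.exp (8 * (p * q ^ 2) ^ 2 * T ^ 3) + Real.exp (-T) * Real.exp (m * 2) := by
        rcases le_or_gt m T with hmT | hmT
        · have h1 : m ^ 3 ≤ T ^ 3 := pow_le_pow_left₀ hm0 hmT 3
          have h2 : Real.exp (8 * (p * q ^ 2) ^ 2 * m ^ 3)
              ≤ Real.exp (8 * (p * q ^ 2) ^ 2 * T ^ 3) :=
            Real.exp_le_exp.2 (mul_le_mul_of_nonneg_left h1 (by positivity))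
          linarith [mul_pos (Real.exp_pos (-T)) (Real.exp_pos (m * 2))]
        · have h1 : m ^ 2 ≤ (2 * k) ^ 2 := pow_le_pow_left₀ hm0 hm2k 2
          have h2 := mul_le_mul_of_nonneg_left h1 (by positivity : 0 ≤ 8 * (p * q ^ 2) ^ 2 * m)
          have h3 := mul_le_mul_of_nonneg_left hkpq hm0
          have h4 : Real.exp (8 * (p * q ^ 2) ^ 2 * m ^ 3) ≤ Real.exp (-T + m * 2) := by
            refine Real.exp_le_exp.2 ?_
            nlinarith
          rw [← Real.exp_add]
          linarith [Real.exp_pos (8 * (p * q ^ 2) ^ 2 * T ^ 3)]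
      have := mul_le_mul_of_nonneg_left hexp hSS
      linarith
  refine (Finset.sum_le_sum fun S _ => Finset.sum_le_sum fun S' _ => hterm S S').trans ?_
  simp only [Finset.sum_add_distrib, ← Finset.mul_sum]
  rw [sum_communityMass]
  simp only [mul_one]
  rw [sum_communityMass, sum_sum_communityMass_mul_pow, mul_one]
  have hn7 : Real.exp 2 - 1 ≤ 7 := by
    have h1 : Real.exp 2 = Real.exp 1 ^ 2 := by rw [← Real.exp_nat_mul]; norm_num
    have h2 : Real.exp 1 ^ 2 ≤ 2.8 ^ 2 :=
      pow_le_pow_left₀ (Real.exp_pos 1).le (by linarith [Real.exp_one_lt_d9]) 2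
    rw [h1]; norm_num at h2 ⊢; linarith
  have hn0 : 0 ≤ Real.exp 2 - 1 := by linarith [Real.add_one_le_exp 2]
  have h5 : (1 + (k / n) ^ 2 * (Real.exp 2 - 1)) ^ n ≤ Real.exp (7 * (k ^ 2 / n)) := by
    have e1 : (k / n) ^ 2 * (Real.exp 2 - 1) = (k ^ 2 / n * (Real.exp 2 - 1)) / n := by
      ring
    rw [e1]
    refine (one_add_div_pow_le ?_).trans (Real.exp_le_exp.2 ?_)
    · have : 0 ≤ k ^ 2 / n * (Real.exp 2 - 1) := by positivity
      linarith [(Nat.cast_nonneg n : (0 : ℝ) ≤ n)]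
    · rw [mul_comm]
      exact mul_le_mul_of_nonneg_right hn7 (by positivity)
  have h6 := mul_le_mul_of_nonneg_left h5 (Real.exp_pos (-T)).le
  rw [← Real.exp_add] at h6
  have h7 : -T + 7 * (k ^ 2 / n) = 7 * (k ^ 2 / n) - T := by ring
  rw [h7] at h6
  linarith

lemma sq_edgeExp_le {ι : Type*} [Fintype ι] [DecidableEq ι] {r : ι → ℝ} (hp0 : 0 ≤ p)
    (hp1 : p ≤ 1) (hr : ∀ e, |r e| ≤ 1 / 2) (f : (ι → SignType) → ℝ) :
    edgeExp p r f ^ 2 ≤ edgeExp p r (fun ω => f ω ^ 2) := by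
  have hw1 : ∀ e, ∑ y, edgeMass p (r e) y = 1 := fun e => sum_edgeMass p (r e)
  have hw0 : ∀ e y, 0 ≤ edgeMass p (r e) y := fun e y => edgeMass_nonneg hp0 hp1 (hr e) y
  have h1 : ∑ ω : ι → SignType, ∏ e, edgeMass p (r e) (ω e) = 1 := by
    have := prodExp_const hw1 1
    simpa [prodExp] using this
  exact Real.pow_arith_mean_le_arith_mean_pow_of_even _ _ _
    (fun ω _ => Finset.prod_nonneg fun e _ => hw0 e _) h1 even_two

/-- The planted mass dominates its restriction to communities of moderate size. -/
lemma nullMass_mul_truncRatio_le (hp0 : 0 ≤ p) (hp1 : p ≤ 1) (hk0 : 0 ≤ k) (hkn : k ≤ n)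
    (hq0 : 0 ≤ q) (hq1 : q ≤ 1 / 2) (Y : OrientedGraph n) :
    nullMass n p Y * truncRatio n k q (edgeVec Y) ≤ plantedMass n p k q Y := by
  unfold truncRatio plantedMass
  rw [Finset.mul_sum]
  refine Finset.sum_le_sum fun S _ => ?_
  have h1 : ∑ π : Equiv.Perm {x : Fin n // x ∈ S}, 1 / (S.card.factorial : ℝ) * condMass p q S π Y
      = nullMass n p Y
        * permAvg fun π : Equiv.Perm {x : Fin n // x ∈ S} => condRatio q S π (edgeVec Y) := by
    simp only [condMass_eq_mul]
    unfold permAvg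
    rw [Fintype.card_coe, ← Finset.mul_sum, ← Finset.mul_sum]
    ring
  have h2 : 0 ≤ ∑ π : Equiv.Perm {x : Fin n // x ∈ S},
      1 / (S.card.factorial : ℝ) * condMass p q S π Y :=
    Finset.sum_nonneg fun π _ =>
      mul_nonneg (by positivity) (condMass_nonneg hp0 hp1 hq0 hq1 S π Y)
  calc _ = truncMass n k S * ∑ π : Equiv.Perm {x : Fin n // x ∈ S},
        1 / (S.card.factorial : ℝ) * condMass p q S π Y := by rw [h1]; ring
    _ ≤ _ := mul_le_mul_of_nonneg_right (truncMass_le hk0 hkn S) h2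

/-- Every test has total error close to `1` if the second moment of the truncated likelihood ratio
is close to `1`. -/
lemma one_sub_sqrt_le_error (hp0 : 0 ≤ p) (hp1 : p ≤ 1) (hk0 : 0 ≤ k) (hkn : k ≤ n)
    (hq0 : 0 ≤ q) (hq1 : q ≤ 1 / 2) (hkpq : 32 * (p * q ^ 2 * k) ^ 2 ≤ 1) (T : ℝ)
    (A : OrientedGraph n → Bool) :
    1 - √(Real.exp (8 * (p * q ^ 2) ^ 2 * T ^ 3) + Real.exp (7 * (k ^ 2 / n) - T) - 1
        + 2 * Real.exp (-(k / 10)))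
      ≤ (∑ Y ∈ Finset.univ.filter (fun Y => A Y = true), nullMass n p Y)
        + ∑ Y ∈ Finset.univ.filter (fun Y => A Y = false), plantedMass n p k q Y := by
  have hr : ∀ _ : pairs n, |(0 : ℝ)| ≤ 1 / 2 := fun _ => by norm_num
  have hw1 : ∀ _ : pairs n, ∑ y, edgeMass p 0 y = 1 := fun _ => sum_edgeMass p 0
  set L := truncRatio n k q with hL
  have hV : edgeExp p (fun _ : pairs n => 0) (fun ω => |1 - L ω| ^ 2)
      ≤ Real.exp (8 * (p * q ^ 2) ^ 2 * T ^ 3) + Real.exp (7 * (k ^ 2 / n) - T) - 1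
        + 2 * Real.exp (-(k / 10)) := by
    have h1 : ∀ ω, |1 - L ω| ^ 2 = L ω ^ 2 - 2 * L ω + 1 := fun ω => by rw [sq_abs]; ring
    have h2 := edgeExp_truncRatio_sq_le hp0 hp1 hk0 hkn hq0 hq1 hkpq T
    have h3 := edgeExp_truncRatio_ge (p := p) (q := q) hk0 hkn
    rw [← hL] at h2 h3
    simp only [h1]
    unfold edgeExp at *
    rw [prodExp_add, prodExp_sub, prodExp_const_mul, prodExp_const hw1]
    linarith
  have hD : edgeExp p (fun _ : pairs n => 0) (fun ω => |1 - L ω|)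
      ≤ √(Real.exp (8 * (p * q ^ 2) ^ 2 * T ^ 3) + Real.exp (7 * (k ^ 2 / n) - T) - 1
        + 2 * Real.exp (-(k / 10))) :=
    Real.le_sqrt_of_sq_le ((sq_edgeExp_le hp0 hp1 hr _).trans hV)
  have hsum : ∀ f : (pairs n → SignType) → ℝ, ∑ Y : OrientedGraph n, nullMass n p Y * f (edgeVec Y)
      = edgeExp p (fun _ : pairs n => 0) f := fun f => sum_prod_edgeMass p (fun _ _ => 0) f
  have hkey : edgeExp p (fun _ : pairs n => 0) (fun ω => 1 - |1 - L ω|)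
      ≤ (∑ Y ∈ Finset.univ.filter (fun Y => A Y = true), nullMass n p Y)
        + ∑ Y ∈ Finset.univ.filter (fun Y => A Y = false), plantedMass n p k q Y := by
    rw [← hsum, Finset.sum_filter, Finset.sum_filter, ← Finset.sum_add_distrib]
    refine Finset.sum_le_sum fun Y _ => ?_
    have hY := nullMass_nonneg hp0 hp1 Y
    cases hA : A Y
    · have h1 := nullMass_mul_truncRatio_le hp0 hp1 hk0 hkn hq0 hq1 Y
      have h2 : 1 - |1 - L (edgeVec Y)| ≤ L (edgeVec Y) := by
        linarith [le_abs_self (1 - L (edgeVec Y))]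
      have := mul_le_mul_of_nonneg_left h2 hY
      simp only [Bool.false_eq_true, if_false, if_true, zero_add]
      linarith
    · have h2 : 1 - |1 - L (edgeVec Y)| ≤ 1 := by linarith [abs_nonneg (1 - L (edgeVec Y))]
      have := mul_le_mul_of_nonneg_left h2 hY
      simp only [Bool.true_eq_false, if_false, if_true, add_zero]
      linarith
  have hsub : edgeExp p (fun _ : pairs n => 0) (fun ω => 1 - |1 - L ω|)
      = 1 - edgeExp p (fun _ : pairs n => 0) (fun ω => |1 - L ω|) := by
    unfold edgeExp
    rw [prodExp_sub, prodExp_const hw1]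
  linarith

end SecondMoment

/-! ### The log-density setting -/

lemma tendsto_natCast_rpow_neg {c : ℝ} (hc : c < 0) :
    Tendsto (fun n : ℕ => (n : ℝ) ^ c) atTop (𝓝 0) := by
  have := (tendsto_rpow_neg_atTop (y := -c) (by linarith)).comp tendsto_natCast_atTop_atTop
  simpa [Function.comp_def] using this

lemma tendsto_natCast_rpow_atTop {c : ℝ} (hc : 0 < c) :
    Tendsto (fun n : ℕ => (n : ℝ) ^ c) atTop atTop :=
  (tendsto_rpow_atTop hc).comp tendsto_natCast_atTop_atTop

/-- The parameters of the log-density setting are admissible for large `n`. -/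
lemma eventually_admissible {α β γ : ℝ} (hα : α ∈ Set.Ioo (0 : ℝ) 1)
    (hβ : β ∈ Set.Ioo (0 : ℝ) 1) (hγ : γ ∈ Set.Ioo (0 : ℝ) 1) :
    ∀ᶠ n : ℕ in atTop, 1 ≤ n ∧ 0 < (n : ℝ) ^ (-γ) ∧ (n : ℝ) ^ (-γ) ≤ 1 ∧ 8 ≤ (n : ℝ) ^ β ∧
      (n : ℝ) ^ β ≤ n ∧ 0 < (n : ℝ) ^ (-α) ∧ (n : ℝ) ^ (-α) ≤ 1 / 2 := by
  filter_upwards [eventually_ge_atTop 1,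
    (tendsto_natCast_rpow_atTop hβ.1).eventually_ge_atTop 8,
    (tendsto_natCast_rpow_neg (c := -α) (by linarith [hα.1])).eventually_le_const
      (by norm_num : (0 : ℝ) < 1 / 2)] with n hn hk hq
  have hn' : (1 : ℝ) ≤ n := by exact_mod_cast hn
  refine ⟨hn, by positivity, Real.rpow_le_one_of_one_le_of_nonpos hn' (by linarith [hγ.1]), hk, ?_,
    by positivity, hq⟩
  calc (n : ℝ) ^ β ≤ (n : ℝ) ^ (1 : ℝ) := Real.rpow_le_rpow_of_exponent_le hn' hβ.2.le
    _ = n := Real.rpow_one _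

open Classical in
lemma strongDetection_of_event {α β γ : ℝ} (hα : α ∈ Set.Ioo (0 : ℝ) 1)
    (hβ : β ∈ Set.Ioo (0 : ℝ) 1) (hγ : γ ∈ Set.Ioo (0 : ℝ) 1)
    (P : (n : ℕ) → (pairs n → SignType) → Prop) (B : ℕ → ℝ) (hB : Tendsto B atTop (𝓝 0))
    (h0 : ∀ᶠ n : ℕ in atTop,
      edgeExp ((n : ℝ) ^ (-γ)) (fun _ : pairs n => 0) (fun ω => if P n ω then 1 else 0) ≤ B n)
    (h1 : ∀ᶠ n : ℕ in atTop, ∀ (S : Finset (Fin n)) (π : Equiv.Perm {x : Fin n // x ∈ S}),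
      (n : ℝ) ^ β / 2 ≤ (S.card : ℝ) →
      edgeExp ((n : ℝ) ^ (-γ)) (fun e : pairs n => bias ((n : ℝ) ^ (-α)) S π e.1.1 e.1.2)
        (fun ω => if P n ω then 0 else 1) ≤ B n) :
    StrongDetection (logNull γ) (logPlanted α β γ) (fun n Y => decide (P n (edgeVec Y))) := by
  have hk : Tendsto (fun n : ℕ => Real.exp (-((n : ℝ) ^ β / 10))) atTop (𝓝 0) :=
    Real.tendsto_exp_neg_atTop_nhds_zero.comp
      ((tendsto_natCast_rpow_atTop hβ.1).atTop_div_const (by norm_num))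
  have hlim : Tendsto (fun n : ℕ => B n + (Real.exp (-((n : ℝ) ^ β / 10)) + B n)) atTop (𝓝 0) := by
    simpa using hB.add (hk.add hB)
  refine tendsto_of_tendsto_of_tendsto_of_le_of_le' tendsto_const_nhds hlim ?_ ?_
  · filter_upwards [eventually_admissible hα hβ hγ] with n ⟨_, hp0, hp1, hk8, hkn, hq0, hq1⟩
    refine add_nonneg (Finset.sum_nonneg fun Y _ => ?_) (Finset.sum_nonneg fun Y _ => ?_)
    · exact nullMass_nonneg hp0.le hp1 Y
    · exact plantedMass_nonneg hp0.le hp1 (by linarith) hkn hq0.le hq1 Y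
  · filter_upwards [eventually_admissible hα hβ hγ, h0, h1]
      with n ⟨_, hp0, hp1, hk8, hkn, hq0, hq1⟩ h0 h1
    have hB0 : 0 ≤ B n := by
      refine le_trans (prodExp_nonneg (fun _ y => edgeMass_nonneg hp0.le hp1 (by norm_num) y)
        fun ω => ?_) h0
      split_ifs <;> norm_num
    have hnull := sum_nullMass_filter (n := n) (p := (n : ℝ) ^ (-γ)) (P n)
    refine add_le_add ?_
      (sum_plantedMass_filter_le hp0.le hp1 (by linarith) hkn hq0.le hq1 (P n) hB0 h1)
    exact hnull.le.trans h0

lemma rpow_neg_sq (n : ℕ) (α : ℝ) : ((n : ℝ) ^ (-α)) ^ 2 = (n : ℝ) ^ (-(2 * α)) := by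
  rw [← Real.rpow_natCast, ← Real.rpow_mul (Nat.cast_nonneg n)]
  congr 1; push_cast; ring

lemma strongDetection_scan {α β γ : ℝ} (hα : α ∈ Set.Ioo (0 : ℝ) 1)
    (hβ : β ∈ Set.Ioo (0 : ℝ) 1) (hγ : γ ∈ Set.Ioo (0 : ℝ) 1) (h : 2 * α + γ < β) :
    ∃ A : Test, StrongDetection (logNull γ) (logPlanted α β γ) A := by
  classical
  set ε := β - 2 * α - γ with hε
  have hε0 : 0 < ε := by rw [hε]; linarith
  -- the polynomial number of candidates is beaten by `exp (-n ^ ε / 32)`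
  have hb : Tendsto (fun n : ℕ => (n : ℝ) ^ (2 : ℝ) * Real.exp (-(1 / 32) * (n : ℝ) ^ ε)) atTop
      (𝓝 0) := by
    have h1 := (tendsto_rpow_mul_exp_neg_mul_atTop_nhds_zero (2 / ε) (1 / 32) (by norm_num)).comp
      (tendsto_natCast_rpow_atTop hε0)
    refine h1.congr fun n => ?_
    simp only [Function.comp]
    rw [← Real.rpow_mul (Nat.cast_nonneg n)]
    congr 2
    field_simp
  have hc : Tendsto (fun n : ℕ => (n : ℝ) ^ (-(β + ε))) atTop (𝓝 0) :=
    tendsto_natCast_rpow_neg (by linarith [hβ.1])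
  have hB : Tendsto (fun n : ℕ => 2 * ((n : ℝ) ^ (2 : ℝ) * Real.exp (-(1 / 32) * (n : ℝ) ^ ε))
      + 16 * (n : ℝ) ^ (-(β + ε))) atTop (𝓝 0) := by
    simpa using (hb.const_mul 2).add (hc.const_mul 16)
  have hrate : ∀ n : ℕ, 1 ≤ n → (n : ℝ) ^ (-γ) * ((n : ℝ) ^ (-α)) ^ 2 * (n : ℝ) ^ β
      = (n : ℝ) ^ ε := by
    intro n hn
    have hn' : (0 : ℝ) < n := by exact_mod_cast hn
    rw [rpow_neg_sq n, ← Real.rpow_add hn', ← Real.rpow_add hn']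
    congr 1; rw [hε]; ring
  refine ⟨_, strongDetection_of_event hα hβ hγ
    (fun n => ScanEvent n ((n : ℝ) ^ (-γ)) ((n : ℝ) ^ β) ((n : ℝ) ^ (-α))) _ hB ?_ ?_⟩
  · filter_upwards [eventually_admissible hα hβ hγ, hb.eventually_le_const one_pos]
      with n ⟨hn, hp0, hp1, hk8, hkn, hq0, hq1⟩ hsmall
    have hn' : (1 : ℝ) ≤ n := by exact_mod_cast hn
    have hs : (n : ℝ) ^ (-γ) * ((n : ℝ) ^ (-α)) ^ 2 * (n : ℝ) ^ β / 32 = 1 / 32 * (n : ℝ) ^ ε := by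
      rw [hrate n hn]; ring
    have hexp := Real.exp_pos (-(1 / 32 * (n : ℝ) ^ ε))
    rw [neg_mul, Real.rpow_two] at hsmall
    refine (scan_null_le hp0 hp1 (by linarith) hq0 hq1 ?_).trans ?_
    · rw [hs]
      refine le_trans (mul_le_mul_of_nonneg_right ?_ hexp.le) hsmall
      nlinarith
    · rw [hs, neg_mul, Real.rpow_two]
      have h1 : ((n : ℝ) + 1) * n ≤ 2 * n ^ 2 := by nlinarith
      have h2 := mul_le_mul_of_nonneg_right h1 hexp.le
      have h3 : 0 ≤ 16 * (n : ℝ) ^ (-(β + ε)) := by positivity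
      linarith
  · filter_upwards [eventually_admissible hα hβ hγ]
      with n ⟨hn, hp0, hp1, hk8, hkn, hq0, hq1⟩ S π hS
    have hn' : (0 : ℝ) < n := by exact_mod_cast hn
    refine (scan_planted_le hp0 hp1 (by linarith) hq0 hq1 S π hS).trans ?_
    have h1 : 16 / ((n : ℝ) ^ (-γ) * ((n : ℝ) ^ (-α)) ^ 2 * ((n : ℝ) ^ β) ^ 2)
        = 16 * (n : ℝ) ^ (-(β + ε)) := by
      rw [sq ((n : ℝ) ^ β), ← mul_assoc, hrate n hn, ← Real.rpow_add hn', Real.rpow_neg hn'.le,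
        div_eq_mul_inv, add_comm]
    rw [h1]
    have : 0 ≤ 2 * ((n : ℝ) ^ (2 : ℝ) * Real.exp (-(1 / 32) * (n : ℝ) ^ ε)) := by positivity
    linarith

lemma strongDetection_degree {α β γ : ℝ} (hα : α ∈ Set.Ioo (0 : ℝ) 1)
    (hβ : β ∈ Set.Ioo (0 : ℝ) 1) (hγ : γ ∈ Set.Ioo (0 : ℝ) 1)
    (h : 2 / 3 * α + 1 / 3 * γ + 1 / 2 < β) :
    ∃ A : Test, StrongDetection (logNull γ) (logPlanted α β γ) A := by
  classical
  set η := 3 * β - 2 * α - γ with hη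
  have hη0 : 3 / 2 < η := by rw [hη]; linarith
  have hB : Tendsto (fun n : ℕ => 6144 * (n : ℝ) ^ (1 - η) + 49152 * (n : ℝ) ^ (3 - 2 * η)
      + 8192 * (n : ℝ) ^ (2 + γ - 2 * η)) atTop (𝓝 0) := by
    have h1 := (tendsto_natCast_rpow_neg (c := 1 - η) (by linarith)).const_mul 6144
    have h2 := (tendsto_natCast_rpow_neg (c := 3 - 2 * η) (by linarith)).const_mul 49152
    have h3 := (tendsto_natCast_rpow_neg (c := 2 + γ - 2 * η) (by linarith [hγ.2])).const_mul 8192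
    simpa using (h1.add h2).add h3
  have hrate : ∀ n : ℕ, 1 ≤ n → degreeErr n ((n : ℝ) ^ (-γ))
      ((n : ℝ) ^ (-γ) * ((n : ℝ) ^ (-α)) ^ 2 * ((n : ℝ) ^ β) ^ 3 / 8)
      = 6144 * (n : ℝ) ^ (1 - η) + 49152 * (n : ℝ) ^ (3 - 2 * η)
        + 8192 * (n : ℝ) ^ (2 + γ - 2 * η) := by
    intro n hn
    have hn' : (0 : ℝ) < n := by exact_mod_cast hn
    have hs : (n : ℝ) ^ (-γ) * ((n : ℝ) ^ (-α)) ^ 2 * ((n : ℝ) ^ β) ^ 3 = (n : ℝ) ^ η := by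
      rw [rpow_neg_sq n, ← Real.rpow_natCast ((n : ℝ) ^ β), ← Real.rpow_mul hn'.le,
        ← Real.rpow_add hn', ← Real.rpow_add hn']
      congr 1; rw [hη]; push_cast; ring
    have e1 : (n : ℝ) ^ (1 - η) = n / (n : ℝ) ^ η := by
      rw [Real.rpow_sub hn', Real.rpow_one]
    have e2 : (n : ℝ) ^ (3 - 2 * η) = (n : ℝ) ^ 3 / ((n : ℝ) ^ η) ^ 2 := by
      rw [Real.rpow_sub hn', mul_comm 2 η, Real.rpow_mul hn'.le]
      norm_cast
    have e3 : (n : ℝ) ^ (2 + γ - 2 * η) = (n : ℝ) ^ 2 / ((n : ℝ) ^ (-γ) * ((n : ℝ) ^ η) ^ 2) := by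
      rw [Real.rpow_sub hn', mul_comm 2 η, Real.rpow_mul hn'.le, Real.rpow_add hn',
        Real.rpow_neg hn'.le, Real.rpow_two, Real.rpow_two]
      field_simp
    rw [hs, e1, e2, e3, degreeErr]
    have hη' : 0 < (n : ℝ) ^ η := by positivity
    have hγ' : 0 < (n : ℝ) ^ (-γ) := by positivity
    field_simp
    ring
  refine ⟨_, strongDetection_of_event hα hβ hγ
    (fun n => DegreeEvent n ((n : ℝ) ^ (-γ)) ((n : ℝ) ^ β) ((n : ℝ) ^ (-α))) _ hB ?_ ?_⟩
  · filter_upwards [eventually_admissible hα hβ hγ] with n ⟨hn, hp0, hp1, hk8, hkn, hq0, hq1⟩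
    rw [← hrate n hn]
    exact degree_null_le hp0 hp1 hk8 hq0 hn
  · filter_upwards [eventually_admissible hα hβ hγ]
      with n ⟨hn, hp0, hp1, hk8, hkn, hq0, hq1⟩ S π hS
    rw [← hrate n hn]
    exact degree_planted_le hp0 hp1 hk8 hq0 hq1 hn S π hS

lemma totalError_le_three {α β γ : ℝ} (hα : α ∈ Set.Ioo (0 : ℝ) 1)
    (hβ : β ∈ Set.Ioo (0 : ℝ) 1) (hγ : γ ∈ Set.Ioo (0 : ℝ) 1) (A : Test) :
    ∀ᶠ n : ℕ in atTop, totalError (logNull γ) (logPlanted α β γ) A n ≤ 3 := by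
  filter_upwards [eventually_admissible hα hβ hγ] with n ⟨_, hp0, hp1, hk8, hkn, hq0, hq1⟩
  have hr : ∀ _ : pairs n, |(0 : ℝ)| ≤ 1 / 2 := fun _ => by norm_num
  have h1 := sum_nullMass_filter (n := n) (p := (n : ℝ) ^ (-γ)) (fun _ => True)
  have h2 := edgeExp_indicator_le_one hp0.le hp1 hr (fun _ : pairs n → SignType => True)
  have h3 := sum_plantedMass_filter_le hp0.le hp1 (by linarith : 0 ≤ (n : ℝ) ^ β) hkn hq0.le hq1
    (fun _ => False) zero_le_one (fun S π _ => by
      have := edgeExp_indicator_le_one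
        (r := fun e : pairs n => bias ((n : ℝ) ^ (-α)) S π e.1.1 e.1.2) hp0.le hp1
        (fun e => (abs_bias_le hq0.le S π _ _).trans hq1)
        (fun _ : pairs n → SignType => True)
      simpa using this)
  simp only [decide_true, decide_false, Finset.filter_true] at h1 h3
  have h4 : Real.exp (-((n : ℝ) ^ β / 10)) ≤ 1 := Real.exp_le_one_iff.2 (by linarith)
  have h5 : ∑ Y ∈ Finset.univ.filter (fun Y => A n Y = true), logNull γ n Y
      ≤ ∑ Y : OrientedGraph n, nullMass n ((n : ℝ) ^ (-γ)) Y :=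
    Finset.sum_le_sum_of_subset_of_nonneg (Finset.filter_subset _ _) fun Y _ _ =>
      nullMass_nonneg hp0.le hp1 Y
  have h6 : ∑ Y ∈ Finset.univ.filter (fun Y => A n Y = false), logPlanted α β γ n Y
      ≤ ∑ Y : OrientedGraph n, plantedMass n ((n : ℝ) ^ (-γ)) ((n : ℝ) ^ β) ((n : ℝ) ^ (-α)) Y := by
    exact Finset.sum_le_sum_of_subset_of_nonneg (Finset.filter_subset _ _) fun Y _ _ =>
      plantedMass_nonneg hp0.le hp1 (by linarith) hkn hq0.le hq1 Y
  unfold totalError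
  linarith

/-- Below the threshold, every test has total error at least `1 - o(1)`. -/
lemma exists_le_totalError {α β γ : ℝ} (hα : α ∈ Set.Ioo (0 : ℝ) 1)
    (hβ : β ∈ Set.Ioo (0 : ℝ) 1) (hγ : γ ∈ Set.Ioo (0 : ℝ) 1) (h1 : β < 2 * α + γ)
    (h2 : β < 2 / 3 * α + 1 / 3 * γ + 1 / 2) :
    ∃ g : ℕ → ℝ, Tendsto g atTop (𝓝 1) ∧ ∀ A : Test,
      ∀ᶠ n : ℕ in atTop, g n ≤ totalError (logNull γ) (logPlanted α β γ) A n := by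
  -- the cutoff `n ^ τ` for the size of the intersection of two communities: above its mean
  -- `n ^ (2 β - 1)`, and such that `(p q²)² n ^ (3 τ)` vanishes
  obtain ⟨τ, hτ1, hτ2⟩ : ∃ τ, max (2 * β - 1) 0 < τ ∧ τ < (4 * α + 2 * γ) / 3 := by
    refine exists_between (max_lt ?_ ?_)
    · linarith
    · linarith [hα.1, hγ.1]
  have hτ0 : 0 < τ := (le_max_right _ _).trans_lt hτ1
  have hτβ : 2 * β - 1 < τ := (le_max_left _ _).trans_lt hτ1
  have hkap : ∀ n : ℕ, 1 ≤ n → (n : ℝ) ^ (-γ) * ((n : ℝ) ^ (-α)) ^ 2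
      = (n : ℝ) ^ (-(2 * α + γ)) := by
    intro n hn
    have hn' : (0 : ℝ) < n := by exact_mod_cast hn
    rw [rpow_neg_sq n, ← Real.rpow_add hn']
    congr 1; ring
  let V : ℕ → ℝ := fun n => Real.exp (8 * (n : ℝ) ^ (3 * τ - (4 * α + 2 * γ)))
    + Real.exp ((n : ℝ) ^ τ * (7 * (n : ℝ) ^ (2 * β - 1 - τ) - 1)) - 1
    + 2 * Real.exp (-((n : ℝ) ^ β / 10))
  have hV : Tendsto V atTop (𝓝 0) := by
    have a1 : Tendsto (fun n : ℕ => Real.exp (8 * (n : ℝ) ^ (3 * τ - (4 * α + 2 * γ)))) atTop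
        (𝓝 1) := by
      have := (tendsto_natCast_rpow_neg (c := 3 * τ - (4 * α + 2 * γ)) (by linarith)).const_mul 8
      have := (Real.continuous_exp.tendsto _).comp this
      simpa [Function.comp_def] using this
    have a2 : Tendsto (fun n : ℕ => Real.exp ((n : ℝ) ^ τ * (7 * (n : ℝ) ^ (2 * β - 1 - τ) - 1)))
        atTop (𝓝 0) := by
      refine Real.tendsto_exp_atBot.comp ?_
      have b1 : Tendsto (fun n : ℕ => 7 * (n : ℝ) ^ (2 * β - 1 - τ) - 1) atTop (𝓝 (-1)) := by
        have := ((tendsto_natCast_rpow_neg (c := 2 * β - 1 - τ) (by linarith)).const_mul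
          7).sub_const 1
        simpa using this
      exact (tendsto_natCast_rpow_atTop hτ0).atTop_mul_neg (by norm_num) b1
    have a3 : Tendsto (fun n : ℕ => Real.exp (-((n : ℝ) ^ β / 10))) atTop (𝓝 0) :=
      Real.tendsto_exp_neg_atTop_nhds_zero.comp
        ((tendsto_natCast_rpow_atTop hβ.1).atTop_div_const (by norm_num))
    have := ((a1.add a2).sub_const 1).add (a3.const_mul 2)
    simpa using this
  refine ⟨fun n => 1 - √(V n), ?_, fun A => ?_⟩
  · have := (((Real.continuous_sqrt.tendsto 0).comp hV).const_sub 1)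
    simpa [Function.comp_def] using this
  · have hsmall : ∀ᶠ n : ℕ in atTop, (n : ℝ) ^ (β - (2 * α + γ)) ≤ 1 / 8 :=
      (tendsto_natCast_rpow_neg (by linarith)).eventually_le_const (by norm_num)
    filter_upwards [eventually_admissible hα hβ hγ, hsmall]
      with n ⟨hn, hp0, hp1, hk8, hkn, hq0, hq1⟩ hsm
    have hn' : (0 : ℝ) < n := by exact_mod_cast hn
    have hkpq : 32 * ((n : ℝ) ^ (-γ) * ((n : ℝ) ^ (-α)) ^ 2 * (n : ℝ) ^ β) ^ 2 ≤ 1 := by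
      have e : (n : ℝ) ^ (-γ) * ((n : ℝ) ^ (-α)) ^ 2 * (n : ℝ) ^ β
          = (n : ℝ) ^ (β - (2 * α + γ)) := by
        rw [hkap n hn, ← Real.rpow_add hn']; congr 1; ring
      rw [e]
      have h0 : 0 ≤ (n : ℝ) ^ (β - (2 * α + γ)) := by positivity
      nlinarith
    have h := one_sub_sqrt_le_error hp0.le hp1 (by linarith) hkn hq0.le hq1 hkpq ((n : ℝ) ^ τ) (A n)
    have e1 : ((n : ℝ) ^ (-γ) * ((n : ℝ) ^ (-α)) ^ 2) ^ 2 * ((n : ℝ) ^ τ) ^ 3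
        = (n : ℝ) ^ (3 * τ - (4 * α + 2 * γ)) := by
      rw [hkap n hn, rpow_neg_sq n, ← Real.rpow_natCast ((n : ℝ) ^ τ), ← Real.rpow_mul hn'.le,
        ← Real.rpow_add hn']
      congr 1; push_cast; ring
    have e2 : 7 * (((n : ℝ) ^ β) ^ 2 / n) - (n : ℝ) ^ τ
        = (n : ℝ) ^ τ * (7 * (n : ℝ) ^ (2 * β - 1 - τ) - 1) := by
      have e3 : ((n : ℝ) ^ β) ^ 2 / n = (n : ℝ) ^ (2 * β - 1) := by
        rw [Real.rpow_sub hn', Real.rpow_one, mul_comm 2 β, Real.rpow_mul hn'.le, Real.rpow_two]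
      rw [e3, Real.rpow_sub hn' (2 * β - 1) τ]
      field_simp
    rw [mul_assoc 8, e1, e2] at h
    exact h

end PRS

theorem mainTheorem2 (α β γ : ℝ) (hα : α ∈ Set.Ioo (0 : ℝ) 1) (hβ : β ∈ Set.Ioo (0 : ℝ) 1)
    (hγ : γ ∈ Set.Ioo (0 : ℝ) 1) :
    (min (2 * α + γ) (2 / 3 * α + 1 / 3 * γ + 1 / 2) < β →
      ∃ A : PRS.Test, PRS.StrongDetection (PRS.logNull γ) (PRS.logPlanted α β γ) A) ∧
    (β < min (2 * α + γ) (2 / 3 * α + 1 / 3 * γ + 1 / 2) →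
      (¬ ∃ A : PRS.Test, PRS.WeakDetection (PRS.logNull γ) (PRS.logPlanted α β γ) A) ∧
      (¬ ∃ A : PRS.Test, PRS.StrongDetection (PRS.logNull γ) (PRS.logPlanted α β γ) A)) := by
  refine ⟨fun h => ?_, fun h => ?_⟩
  · rcases min_lt_iff.1 h with h | h
    · exact PRS.strongDetection_scan hα hβ hγ h
    · exact PRS.strongDetection_degree hα hβ hγ h
  · obtain ⟨h1, h2⟩ := lt_min_iff.1 h
    obtain ⟨g, hg, hgA⟩ := PRS.exists_le_totalError hα hβ hγ h1 h2
    have hweak : ¬ ∃ A : PRS.Test, PRS.WeakDetection (PRS.logNull γ) (PRS.logPlanted α β γ) A := by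
      rintro ⟨A, δ, hδ, hA⟩
      have hlow : ∀ᶠ n in atTop, 1 - δ / 2
          ≤ PRS.totalError (PRS.logNull γ) (PRS.logPlanted α β γ) A n := by
        filter_upwards [hgA A, hg.eventually_const_le (by linarith : 1 - δ / 2 < 1)] with n h3 h4
        exact h4.trans h3
      have hbdd : IsBoundedUnder (· ≤ ·) atTop
          (PRS.totalError (PRS.logNull γ) (PRS.logPlanted α β γ) A) :=
        ⟨3, by simpa using PRS.totalError_le_three hα hβ hγ A⟩
      have := le_limsup_of_frequently_le hlow.frequently hbdd
      linarith
    refine ⟨hweak, ?_⟩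
    rintro ⟨A, hA⟩
    refine hweak ⟨A, 1, one_pos, ?_⟩
    rw [Tendsto.limsup_eq hA]
    norm_num
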